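/- Let $n \ge 1$. For a bounded domain (nonempty connected bounded open set) $\Omega \subset \mathbb{R}^n$, let $0 < \lambda_1(\Omega) \le \lambda_2(\Omega) \le \lambda_3(\Omega) \le \cdots$ be the eigenvalues, repeated according to multiplicity, of the Dirichlet problem $\Delta u = -\lambda u$ in $\Omega$, $u = 0$ on $\partial\Omega$, understood in the weak sense: $\lambda$ is an eigenvalue with eigenfunction $u \in H^1_0(\Omega) \setminus \{0\}$ if $\int_\Omega \nabla u \cdot \nabla \varphi = \lambda \int_\Omega u \varphi$ for all $\varphi \in C_c^\infty(\Omega)$. Let $C_0(n)$ denote the optimal constant in the Cheng–Yang inequality, that is, the infimum of all real $C$ such that $$\lambda_{k+1}(\Omega) \le C\, k^{2/n}\, \lambda_1(\Omega) \qquad \text{for all bounded domains } \Omega \subset \mathbb{R}^n \text{ and all integers } k \ge 1. \tag{1}$$ Then (1) holds with $C = C_0(n)$ (so $C_0(n)$ is the least constant for which (1) holds), $C_0(n) \le 1 + \frac{4}{n}$, and for every bounded domain $\Omega \subset \mathbb{R}^n$ and every integer $k \ge 1$, $$\lambda_{k+1}(\Omega) - \lambda_k(\Omega) \le C_{n,\Omega}\,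 k^{1/n}, \qquad C_{n,\Omega} = 4 \lambda_1(\Omega) \sqrt{\frac{C_0(n)}{n}} .$$ In particular, the gap estimate holds with $C_0(n)$ replaced by any constant $C$ satisfying (1), for instance $C = 1 + \frac{4}{n}$. -/

import Mathlib

open MeasureTheory

/-- A bounded domain of `ℝⁿ`: a nonempty, connected, open and bounded set. -/
structure IsBoundedDomain {n : ℕ} (Ω : Set (EuclideanSpace ℝ (Fin n))) : Prop where
  isOpen : IsOpen Ω
  isConnected : IsConnected Ω
  isBounded : Bornology.IsBounded Ω

/-- The real Hilbert space `L²(Ω)` of real-valued functions. -/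
abbrev L2Scalar {n : ℕ} (Ω : Set (EuclideanSpace ℝ (Fin n))) : Type :=
  Lp ℝ 2 (volume.restrict Ω)

/-- The real Hilbert space `L²(Ω; ℝⁿ)` of vector fields. -/
abbrev L2Vector {n : ℕ} (Ω : Set (EuclideanSpace ℝ (Fin n))) : Type :=
  Lp (EuclideanSpace ℝ (Fin n)) 2 (volume.restrict Ω)

/-- Test functions: `φ ∈ C_c^∞(Ω)`, extended by zero to `ℝⁿ`. -/
structure IsTestFunction {n : ℕ} (Ω : Set (EuclideanSpace ℝ (Fin n)))
    (φ : EuclideanSpace ℝ (Fin n) → ℝ) : Prop where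
  contDiff : ContDiff ℝ (⊤ : ℕ∞) φ
  hasCompactSupport : HasCompactSupport φ
  tsupport_subset : tsupport φ ⊆ Ω

namespace IsTestFunction

variable {n : ℕ} {Ω : Set (EuclideanSpace ℝ (Fin n))} {φ ψ : EuclideanSpace ℝ (Fin n) → ℝ}

theorem zero : IsTestFunction Ω (fun _ => (0 : ℝ)) :=
  ⟨contDiff_const, HasCompactSupport.zero, by simp [tsupport]⟩

theorem add (hφ : IsTestFunction Ω φ) (hψ : IsTestFunction Ω ψ) :
    IsTestFunction Ω (fun x => φ x + ψ x) :=
  ⟨hφ.contDiff.add hψ.contDiff, hφ.hasCompactSupport.add hψ.hasCompactSupport,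
    (tsupport_add φ ψ).trans (Set.union_subset hφ.tsupport_subset hψ.tsupport_subset)⟩

theorem const_mul (c : ℝ) (hφ : IsTestFunction Ω φ) : IsTestFunction Ω (fun x => c * φ x) :=
  ⟨contDiff_const.mul hφ.contDiff, hφ.hasCompactSupport.mul_left,
    (tsupport_mul_subset_right (f := fun _ => c) (g := φ)).trans hφ.tsupport_subset⟩

theorem differentiable (hφ : IsTestFunction Ω φ) : Differentiable ℝ φ :=
  hφ.contDiff.differentiable (by simp)

theorem gradient_fun_add (hφ : IsTestFunction Ω φ) (hψ : IsTestFunction Ω ψ)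
    (x : EuclideanSpace ℝ (Fin n)) :
    gradient (fun x => φ x + ψ x) x = gradient φ x + gradient ψ x := by
  simp [gradient, fderiv_fun_add (hφ.differentiable x) (hψ.differentiable x)]

theorem gradient_fun_const_mul (c : ℝ) (hφ : IsTestFunction Ω φ)
    (x : EuclideanSpace ℝ (Fin n)) :
    gradient (fun x => c * φ x) x = c • gradient φ x := by
  simp [gradient, fderiv_const_mul (hφ.differentiable x)]

theorem memLp (hφ : IsTestFunction Ω φ) : MemLp φ 2 (volume.restrict Ω) :=
  (hφ.contDiff.continuous.memLp_of_hasCompactSupport hφ.hasCompactSupport).restrict Ω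

theorem memLp_gradient (hφ : IsTestFunction Ω φ) :
    MemLp (gradient φ) 2 (volume.restrict Ω) := by
  have hc : Continuous (gradient φ) :=
    (InnerProductSpace.toDual ℝ (EuclideanSpace ℝ (Fin n))).symm.continuous.comp
      (hφ.contDiff.continuous_fderiv (by simp))
  have hs : HasCompactSupport (gradient φ) :=
    (hφ.hasCompactSupport.fderiv (𝕜 := ℝ)).comp_left
      (g := (InnerProductSpace.toDual ℝ (EuclideanSpace ℝ (Fin n))).symm) (map_zero _)
  exact (hc.memLp_of_hasCompactSupport hs).restrict Ω

theorem integrable_inner_gradient (hφ : IsTestFunction Ω φ) (g : L2Vector Ω) :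
    Integrable (fun x => inner ℝ (g x) (gradient φ x)) (volume.restrict Ω) := by
  refine (L2.integrable_inner (𝕜 := ℝ) g hφ.memLp_gradient.toLp).congr ?_
  filter_upwards [hφ.memLp_gradient.coeFn_toLp] with x hx
  rw [hx]

end IsTestFunction

/-- The pairs `(φ, ∇φ)` with `φ ∈ C_c^∞(Ω)`, as a subspace of `L²(Ω) × L²(Ω; ℝⁿ)`. -/
def testGraph {n : ℕ} (Ω : Set (EuclideanSpace ℝ (Fin n))) :
    Submodule ℝ (L2Scalar Ω × L2Vector Ω) where
  carrier := {p | ∃ φ : EuclideanSpace ℝ (Fin n) → ℝ, IsTestFunction Ω φ ∧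
    p.1 =ᵐ[volume.restrict Ω] φ ∧ p.2 =ᵐ[volume.restrict Ω] gradient φ}
  zero_mem' := by
    refine ⟨fun _ => 0, IsTestFunction.zero, Lp.coeFn_zero _ _ _, ?_⟩
    rw [gradient_fun_const']
    exact Lp.coeFn_zero _ _ _
  add_mem' := by
    rintro p q ⟨φ, hφ, h1, h2⟩ ⟨ψ, hψ, h3, h4⟩
    refine ⟨_, hφ.add hψ, ?_, ?_⟩
    · filter_upwards [Lp.coeFn_add p.1 q.1, h1, h3] with x hx h1 h3
      simp only [Prod.fst_add, hx, Pi.add_apply, h1, h3]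
    · filter_upwards [Lp.coeFn_add p.2 q.2, h2, h4] with x hx h2 h4
      simp only [Prod.snd_add, hx, Pi.add_apply, h2, h4, hφ.gradient_fun_add hψ]
  smul_mem' := by
    rintro c p ⟨φ, hφ, h1, h2⟩
    refine ⟨_, hφ.const_mul c, ?_, ?_⟩
    · filter_upwards [Lp.coeFn_smul c p.1, h1] with x hx h1
      simp only [Prod.smul_fst, hx, Pi.smul_apply, smul_eq_mul, h1]
    · filter_upwards [Lp.coeFn_smul c p.2, h2] with x hx h2
      simp only [Prod.smul_snd, hx, Pi.smul_apply, h2, hφ.gradient_fun_const_mul]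

/-- The pairs `(u, ∇u)` with `u ∈ H¹₀(Ω)`: the closure of the pairs `(φ, ∇φ)`,
`φ ∈ C_c^∞(Ω)`, in `L²(Ω) × L²(Ω; ℝⁿ)`. -/
noncomputable def sobolevGraph {n : ℕ} (Ω : Set (EuclideanSpace ℝ (Fin n))) :
    Submodule ℝ (L2Scalar Ω × L2Vector Ω) :=
  (testGraph Ω).topologicalClosure

/-- The space of solutions `u ∈ H¹₀(Ω)` of the Dirichlet problem `Δu = -ν u` in `Ω`, `u = 0` on
`∂Ω`, in the weak sense: `∫_Ω ∇u · ∇φ = ν ∫_Ω u φ` for all `φ ∈ C_c^∞(Ω)`. -/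
def dirichletEigenspace {n : ℕ} (Ω : Set (EuclideanSpace ℝ (Fin n))) (ν : ℝ) :
    Submodule ℝ (L2Scalar Ω) where
  carrier := {u | ∃ g : L2Vector Ω, (u, g) ∈ sobolevGraph Ω ∧
    ∀ φ : EuclideanSpace ℝ (Fin n) → ℝ, IsTestFunction Ω φ →
      ∫ x in Ω, inner ℝ (g x) (gradient φ x) = ν * ∫ x in Ω, u x * φ x}
  zero_mem' := by
    refine ⟨0, (sobolevGraph Ω).zero_mem, fun φ _ => ?_⟩
    have h1 : ∫ x in Ω, inner ℝ ((0 : L2Vector Ω) x) (gradient φ x) = 0 := by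
      refine integral_eq_zero_of_ae ?_
      filter_upwards [Lp.coeFn_zero (EuclideanSpace ℝ (Fin n)) 2 (volume.restrict Ω)] with x hx
      rw [hx, Pi.zero_apply, inner_zero_left, Pi.zero_apply]
    have h2 : ∫ x in Ω, (0 : L2Scalar Ω) x * φ x = 0 := by
      refine integral_eq_zero_of_ae ?_
      filter_upwards [Lp.coeFn_zero ℝ 2 (volume.restrict Ω)] with x hx
      simp only [hx, Pi.zero_apply, zero_mul]
    rw [h1, h2, mul_zero]
  add_mem' := by
    rintro u v ⟨g, hg, h1⟩ ⟨w, hw, h2⟩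
    refine ⟨g + w, (sobolevGraph Ω).add_mem hg hw, fun φ hφ => ?_⟩
    have e1 : ∫ x in Ω, inner ℝ ((g + w : L2Vector Ω) x) (gradient φ x) =
        (∫ x in Ω, inner ℝ (g x) (gradient φ x)) + ∫ x in Ω, inner ℝ (w x) (gradient φ x) := by
      rw [← integral_add (hφ.integrable_inner_gradient g) (hφ.integrable_inner_gradient w)]
      refine integral_congr_ae ?_
      filter_upwards [Lp.coeFn_add g w] with x hx
      rw [hx, Pi.add_apply, inner_add_left]
    have e2 : ∫ x in Ω, (u + v : L2Scalar Ω) x * φ x =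
        (∫ x in Ω, u x * φ x) + ∫ x in Ω, v x * φ x := by
      rw [← integral_add (f := fun x => u x * φ x) (g := fun x => v x * φ x)
        ((Lp.memLp u).integrable_mul hφ.memLp) ((Lp.memLp v).integrable_mul hφ.memLp)]
      refine integral_congr_ae ?_
      filter_upwards [Lp.coeFn_add u v] with x hx
      rw [hx, Pi.add_apply, add_mul]
    rw [e1, e2, h1 φ hφ, h2 φ hφ, mul_add]
  smul_mem' := by
    rintro c u ⟨g, hg, h1⟩
    refine ⟨c • g, (sobolevGraph Ω).smul_mem c hg, fun φ hφ => ?_⟩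
    have e1 : ∫ x in Ω, inner ℝ ((c • g : L2Vector Ω) x) (gradient φ x) =
        c * ∫ x in Ω, inner ℝ (g x) (gradient φ x) := by
      rw [← integral_const_mul]
      refine integral_congr_ae ?_
      filter_upwards [Lp.coeFn_smul c g] with x hx
      rw [hx, Pi.smul_apply, real_inner_smul_left]
    have e2 : ∫ x in Ω, (c • u : L2Scalar Ω) x * φ x = c * ∫ x in Ω, u x * φ x := by
      rw [← integral_const_mul]
      refine integral_congr_ae ?_
      filter_upwards [Lp.coeFn_smul c u] with x hx
      rw [hx, Pi.smul_apply, smul_eq_mul, mul_assoc]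
    rw [e1, e2, h1 φ hφ]
    ring

/-- The `k`-th Dirichlet eigenvalue `λ_k(Ω)` (`k = 1, 2, …`) in the nondecreasing enumeration
in which each eigenvalue is repeated according to its multiplicity: the least `μ` such that the
eigenvalues `ν ≤ μ`, counted with the dimensions of their eigenspaces, number at least `k`. -/
noncomputable def dirichletEigenvalue {n : ℕ} (Ω : Set (EuclideanSpace ℝ (Fin n))) (k : ℕ) : ℝ :=
  sInf {μ : ℝ | (k : Cardinal) ≤
    Module.rank ℝ ↥(⨆ ν : ℝ, ⨆ _ : ν ≤ μ, dirichletEigenspace Ω ν)}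

/-- `C` is a constant in the inequality `λ_{k+1} ≤ C k^{2/n} λ_1`, valid for all bounded domains
of `ℝⁿ` and all `k ≥ 1`. -/
def IsChengYangConstant (n : ℕ) (C : ℝ) : Prop :=
  ∀ Ω : Set (EuclideanSpace ℝ (Fin n)), IsBoundedDomain Ω → ∀ k : ℕ, 1 ≤ k →
    dirichletEigenvalue Ω (k + 1) ≤ C * (k : ℝ) ^ ((2 : ℝ) / n) * dirichletEigenvalue Ω 1

/-- The optimal constant `C₀(n)` in the inequality `λ_{k+1} ≤ C₀(n) k^{2/n} λ_1`. -/
noncomputable def chengYangConstant (n : ℕ) : ℝ :=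
  sInf {C : ℝ | IsChengYangConstant n C}

/-! ### The recursion derived from Yang's inequality -/

/-! Both the bound on `C₀(n)` and the gap estimate come from commutators of `-Δ` with functions of
one coordinate, expanded in an orthonormal basis of Dirichlet eigenfunctions `u_j`. In the proofs
the eigenvalues are indexed from zero: `l k` is `λ_{k+1}`.

The bound `1 + 4/n`: the commutator of `-Δ` with `x_p` is `-2 ∂_p`. Expanding `x_p u_i` and `-2 ∂_p
u_i` in the basis and summing over `p` gives Yang's inequality (`sum_sq_le_of_commutator`). What
follows is pure algebra with `s = 2/n`: a quadratic expression `F k` in the first `k` eigenvalues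
satisfies `F (k+1) / (k+1)^(2s) ≤ F k / k^(2s)`, and it controls the next eigenvalue
(`le_of_yang_inequality`).

The gap: multiply `u_0` by `cos (α x_p)` and `sin (α x_p)`. No eigenvalue lies strictly between `l
k` and `l (k+1)`, so `(l j - l k)(l j - l (k+1)) ≥ 0` for every `j`. Weighting by squared
coefficients (`consecutive_quadratic_nonneg`), adding the sine and cosine versions, summing over `p`
and optimising `α` yields `(√B - √A)² ≤ 4 λ₁ / n`, where `A`, `B` are the two eigenvalues shifted by
`-λ₁`. Hence the gap is at most `4 √(λ₁ λ_{k+1} / n)`, and bounding `λ_{k+1}` by `C₀(n) k^(2/n) λ₁`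
finishes.

The analytic input is the eigenbasis itself. A Poincaré inequality on small balls makes the
embedding of `H¹₀` into `L²` compact (`sobolevGraph_small_on_finite_codim`), the spectral theorem
for the resolvent then applies (`exists_hilbertBasis_of_compact_form`), and
`dirichletEigenvalue_succ_eq` matches the enumeration with the rank definition. -/

theorem cubic_taylor_mul_one_sub_rpow_le_one {a y : ℝ} (ha : 0 < a) (hy0 : 0 ≤ y) (hy1 : y < 1) :
    (1 + a * y + a * (a + 1) / 2 * y ^ 2 + a * (a + 1) * (a + 2) / 6 * y ^ 3) * (1 - y) ^ a
      ≤ 1 := by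
  set g : ℝ → ℝ := fun y =>
    (1 + a * y + a * (a + 1) / 2 * y ^ 2 + a * (a + 1) * (a + 2) / 6 * y ^ 3) * (1 - y) ^ a
  -- The polynomial is the cubic Taylor polynomial of `(1 - y)^(-a)`, so in the derivative every
  -- term below order three cancels. The rest is nonpositive on `[0, 1)`, and `g 0 = 1`.
  have hd : ∀ x < (1 : ℝ), HasDerivAt g
      (-(a * (a + 1) * (a + 2) * (a + 3) / 6 * x ^ 3) * (1 - x) ^ (a - 1)) x := by
    intro x hx
    have hx' : 0 < 1 - x := by linarith
    have h1 : HasDerivAt (fun y : ℝ => 1 + a * y + a * (a + 1) / 2 * y ^ 2 +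
        a * (a + 1) * (a + 2) / 6 * y ^ 3)
        (a + a * (a + 1) * x + a * (a + 1) * (a + 2) / 2 * x ^ 2) x := by
      have := ((((hasDerivAt_id x).const_mul a).const_add 1).add
        (((hasDerivAt_id x).pow 2).const_mul (a * (a + 1) / 2))).add
        (((hasDerivAt_id x).pow 3).const_mul (a * (a + 1) * (a + 2) / 6))
      convert! this using 1
      simp
      ring
    have h2 : HasDerivAt (fun y : ℝ => (1 - y) ^ a) (-1 * a * (1 - x) ^ (a - 1)) x :=
      ((hasDerivAt_id x).const_sub 1).rpow_const (Or.inl hx'.ne')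
    convert! h1.mul h2 using 1
    have : (1 - x) ^ a = (1 - x) * (1 - x) ^ (a - 1) := by
      rw [← Real.rpow_one_add' hx'.le (by simpa using ha.ne')]
      congr 1; ring
    rw [this]
    ring
  have hanti : AntitoneOn g (Set.Icc 0 y) := by
    apply antitoneOn_of_deriv_nonpos (convex_Icc 0 y)
    · exact fun x hx => (hd x (hx.2.trans_lt hy1)).continuousAt.continuousWithinAt
    · intro x hx
      rw [interior_Icc] at hx
      exact (hd x (hx.2.trans hy1)).differentiableAt.differentiableWithinAt
    · intro x hx
      rw [interior_Icc] at hx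
      rw [(hd x (hx.2.trans hy1)).deriv]
      have h1 := hx.1.le
      have : 0 ≤ (1 - x) ^ (a - 1) := Real.rpow_nonneg (by linarith [hx.2]) _
      have h3 : 0 ≤ a * (a + 1) * (a + 2) * (a + 3) / 6 * x ^ 3 := by positivity
      nlinarith [mul_nonneg h3 this]
  have := hanti (Set.left_mem_Icc.2 hy0) (Set.right_mem_Icc.2 hy0) hy0
  simpa [g] using this

/-- With `y = 1/(k+1)` the power on the right is `(1 - y)^(-2s)`. Its quadratic Taylor polynomial
reproduces the first three terms on the left exactly; the cubic term absorbs the last one, because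
`1/(2k+1) ≤ 2/(3(k+1))` for `k ≥ 1`. -/
theorem yang_recursion_coefficient_le {s k : ℝ} (hs : 0 < s) (hk : 1 ≤ k) :
    (k + 1) ^ 2 + 2 * s * (k + 1) + s * (1 + 2 * s) + s * (1 + s) * (1 + 2 * s) / (2 * k + 1) ≤
      (k + 1) ^ 2 * ((k + 1) / k) ^ (2 * s) := by
  have hk0 : 0 < k := by linarith
  set y : ℝ := 1 / (k + 1) with hy
  have hy0 : 0 < y := by positivity
  have hy1 : y < 1 := by rw [hy, div_lt_one] <;> linarith
  have h1y : 1 - y = k / (k + 1) := by rw [hy]; field_simp; ring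
  have hT := cubic_taylor_mul_one_sub_rpow_le_one (a := 2 * s) (by positivity) hy0.le hy1
  have hinv : ((k + 1) / k) ^ (2 * s) * (1 - y) ^ (2 * s) = 1 := by
    rw [← Real.mul_rpow (by positivity) (by linarith), h1y]
    have : (k + 1) / k * (k / (k + 1)) = 1 := by field_simp
    rw [this, Real.one_rpow]
  have hpos : 0 < (1 - y) ^ (2 * s) := Real.rpow_pos_of_pos (by linarith) _
  have h2 : 1 + 2 * s * y + 2 * s * (2 * s + 1) / 2 * y ^ 2 +
      2 * s * (2 * s + 1) * (2 * s + 2) / 6 * y ^ 3 ≤ ((k + 1) / k) ^ (2 * s) :=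
    le_of_mul_le_mul_right (hT.trans_eq hinv.symm) hpos
  have h3 : (k + 1) ^ 2 * (1 + 2 * s * y + 2 * s * (2 * s + 1) / 2 * y ^ 2 +
      2 * s * (2 * s + 1) * (2 * s + 2) / 6 * y ^ 3) =
      (k + 1) ^ 2 + 2 * s * (k + 1) + s * (1 + 2 * s) +
        s * (1 + s) * (1 + 2 * s) * (2 / (3 * (k + 1))) := by
    rw [hy]; field_simp; ring
  have h4 : 1 / (2 * k + 1) ≤ 2 / (3 * (k + 1)) := by
    rw [div_le_div_iff₀ (by positivity) (by positivity)]
    linarith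
  have h5 : s * (1 + s) * (1 + 2 * s) / (2 * k + 1) ≤
      s * (1 + s) * (1 + 2 * s) * (2 / (3 * (k + 1))) := by
    rw [div_eq_mul_one_div]
    exact mul_le_mul_of_nonneg_left h4 (by positivity)
  calc _ ≤ (k + 1) ^ 2 * (1 + 2 * s * y + 2 * s * (2 * s + 1) / 2 * y ^ 2 +
      2 * s * (2 * s + 1) * (2 * s + 2) / 6 * y ^ 3) := by rw [h3]; linarith
    _ ≤ _ := mul_le_mul_of_nonneg_left h2 (by positivity)

/-- In the application `x` is the next eigenvalue, `G` the mean of the first `k`, `F` the value `F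
k`, and the left side is `(k+1)² F (k+1)`. Yang's inequality `hY` is added with multiplier `m - k`,
with `m` chosen so that the remaining quadratic form in `x`, `G` is nonnegative. -/
theorem yang_quadratic_form_le {s k x G F : ℝ} (hs : 0 < s) (hk : 1 ≤ k)
    (hY : x ^ 2 - 2 * (1 + s) * x * G + (1 + 2 * s) * (1 + s) * G ^ 2 ≤ (1 + 2 * s) * F) :
    -(k * (1 + s) * G ^ 2) + 2 * (1 + s) * k * G * x + (s - k) * x ^ 2 + k * (k + 1) * F ≤
      ((k + 1) ^ 2 + 2 * s * (k + 1) + s * (1 + 2 * s) +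
        s * (1 + s) * (1 + 2 * s) / (2 * k + 1)) * F := by
  -- The discriminant condition on `m = 2k + 1 + s + e` is `e² + (2k+1) e ≥ s (1 + s)`. Dropping
  -- `e²` gives this rational choice, and the surplus `e²` reappears in `hquad`.
  set e : ℝ := s * (1 + s) / (2 * k + 1) with he
  have he0 : 0 < e := by positivity
  have hde : (2 * k + 1) * e = s * (1 + s) := by rw [he]; field_simp
  set m : ℝ := 2 * k + 1 + s + e with hm
  have hms : 0 < m - s := by rw [hm]; linarith
  have hquad : 0 ≤ (m - s) * ((m - s) * x ^ 2 - 2 * (1 + s) * m * x * G +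
      (1 + s) * (m * (1 + 2 * s) - 2 * s * k) * G ^ 2) := by
    have : (m - s) * ((m - s) * x ^ 2 - 2 * (1 + s) * m * x * G +
      (1 + s) * (m * (1 + 2 * s) - 2 * s * k) * G ^ 2) =
      ((m - s) * x - (1 + s) * m * G) ^ 2 + (1 + s) * s * e ^ 2 * G ^ 2 := by
      rw [hm]
      linear_combination (1 + s) * s * G ^ 2 * hde
    rw [this]
    positivity
  have hform := nonneg_of_mul_nonneg_right hquad hms
  have hmk : 0 ≤ m - k := by rw [hm]; linarith
  have h1 := mul_le_mul_of_nonneg_left hY hmk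
  have h2 : s * (1 + s) * (1 + 2 * s) / (2 * k + 1) = e * (1 + 2 * s) := by rw [he]; ring
  rw [h2]
  have h3 : (k + 1) ^ 2 + 2 * s * (k + 1) + s * (1 + 2 * s) + e * (1 + 2 * s) =
      k * (k + 1) + (m - k) * (1 + 2 * s) := by rw [hm]; ring
  rw [h3]
  nlinarith [h1, hform]

/-- If a sequence satisfies Yang's inequality, it grows at most like `k ^ s`. -/
theorem le_of_yang_inequality {s : ℝ} (hs : 0 < s) (l : ℕ → ℝ) (h0 : 0 ≤ l 0)
    (hY : ∀ k : ℕ, ∑ i ∈ Finset.range k, (l k - l i) ^ 2 ≤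
      2 * s * ∑ i ∈ Finset.range k, (l k - l i) * l i) (k : ℕ) (hk : 1 ≤ k) :
    l k ≤ (1 + 2 * s) * (k : ℝ) ^ s * l 0 := by
  set S : ℕ → ℝ := fun k => ∑ i ∈ Finset.range k, l i with hS
  set Q : ℕ → ℝ := fun k => ∑ i ∈ Finset.range k, l i ^ 2 with hQ
  -- This normalisation turns Yang's inequality into an upper bound by `(1 + 2s) F k` of a positive
  -- definite form in `l k` and the mean `S k / k`.
  set F : ℕ → ℝ := fun k => (1 + s) * (S k / k) ^ 2 - Q k / k with hF
  have hyang : ∀ k : ℕ, 1 ≤ k → l k ^ 2 - 2 * (1 + s) * l k * (S k / k) +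
      (1 + 2 * s) * (1 + s) * (S k / k) ^ 2 ≤ (1 + 2 * s) * F k := by
    intro k hk
    have hk0 : (0 : ℝ) < k := by exact_mod_cast hk
    have e1 : ∑ i ∈ Finset.range k, (l k - l i) ^ 2 = k * l k ^ 2 - 2 * l k * S k + Q k := by
      simp only [hS, hQ, sub_sq, Finset.sum_add_distrib, Finset.sum_sub_distrib,
        ← Finset.mul_sum, Finset.sum_const, Finset.card_range, nsmul_eq_mul]
    have e2 : ∑ i ∈ Finset.range k, (l k - l i) * l i = l k * S k - Q k := by
      simp only [hS, hQ, sub_mul, Finset.sum_sub_distrib, ← Finset.mul_sum, pow_two]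
    have h := hY k
    rw [e1, e2] at h
    have h2 : l k ^ 2 - 2 * (1 + s) * l k * (S k / k) + (1 + 2 * s) * (Q k / k) ≤ 0 := by
      have : l k ^ 2 - 2 * (1 + s) * l k * (S k / k) + (1 + 2 * s) * (Q k / k) =
        (k * l k ^ 2 - 2 * l k * S k + Q k - 2 * s * (l k * S k - Q k)) / k := by
        field_simp; ring
      rw [this]
      exact div_nonpos_of_nonpos_of_nonneg (by linarith) hk0.le
    simp only [hF]
    linarith
  have hFnn : ∀ k : ℕ, 1 ≤ k → 0 ≤ F k := by
    intro k hk
    have h := hyang k hk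
    have : 0 ≤ (1 + 2 * s) * F k := by
      nlinarith [sq_nonneg (l k - (1 + s) * (S k / k)),
        mul_nonneg (mul_nonneg hs.le (by positivity : 0 ≤ 1 + s)) (sq_nonneg (S k / k))]
    exact nonneg_of_mul_nonneg_right this (by positivity)
  have hrec : ∀ k : ℕ, 1 ≤ k →
      F (k + 1) ≤ (((k : ℝ) + 1) / k) ^ (2 * s) * F k := by
    intro k hk
    have hk1 : (1 : ℝ) ≤ k := by exact_mod_cast hk
    have hk0 : (0 : ℝ) < k := by linarith
    have h1 := yang_quadratic_form_le hs hk1 (hyang k hk)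
    have h2 := h1.trans (mul_le_mul_of_nonneg_right (yang_recursion_coefficient_le hs hk1)
      (hFnn k hk))
    have h3 : ((k : ℝ) + 1) ^ 2 * F (k + 1) = -(k * (1 + s) * (S k / k) ^ 2) +
        2 * (1 + s) * k * (S k / k) * l k + (s - k) * l k ^ 2 + k * (k + 1) * F k := by
      simp only [hF, hS, hQ, Finset.sum_range_succ, Nat.cast_add, Nat.cast_one]
      field_simp
      ring
    rw [← h3, mul_assoc] at h2
    exact le_of_mul_le_mul_left h2 (by positivity)
  have hF1 : F 1 = s * l 0 ^ 2 := by
    simp [hF, hS, hQ]; ring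
  have hbound : ∀ k : ℕ, 1 ≤ k → F k ≤ (k : ℝ) ^ (2 * s) * (s * l 0 ^ 2) := by
    intro k hk
    induction k, hk using Nat.le_induction with
    | base => simp [hF1]
    | succ k hk ih =>
      have hk0 : (0 : ℝ) < k := by exact_mod_cast hk
      refine (hrec k hk).trans ?_
      refine (mul_le_mul_of_nonneg_left ih (by positivity)).trans_eq ?_
      rw [← mul_assoc, ← Real.mul_rpow (by positivity) hk0.le, div_mul_cancel₀ _ hk0.ne']
      push_cast
      rfl
  have hk0 : (0 : ℝ) < k := by exact_mod_cast hk
  have hfin : l k ^ 2 ≤ ((1 + 2 * s) * (k : ℝ) ^ s * l 0) ^ 2 := by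
    have h := hyang k hk
    -- Minimise the form over the mean: the worst case is `S k / k = l k / (1 + 2s)`, whose square
    -- is discarded.
    have h1 : l k ^ 2 * s ≤ (1 + 2 * s) ^ 2 * F k := by
      have := mul_le_mul_of_nonneg_left h (by positivity : 0 ≤ 1 + 2 * s)
      nlinarith [mul_nonneg (by positivity : 0 ≤ 1 + s)
        (sq_nonneg ((1 + 2 * s) * (S k / k) - l k))]
    have h2 : (1 + 2 * s) ^ 2 * F k ≤ (1 + 2 * s) ^ 2 * ((k : ℝ) ^ (2 * s) * (s * l 0 ^ 2)) :=
      mul_le_mul_of_nonneg_left (hbound k hk) (by positivity)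
    have h3 : (k : ℝ) ^ (2 * s) = ((k : ℝ) ^ s) ^ 2 := by
      rw [mul_comm, Real.rpow_mul hk0.le, Real.rpow_two]
    rw [h3] at h2
    refine le_of_mul_le_mul_right ?_ hs
    calc l k ^ 2 * s ≤ _ := h1.trans h2
      _ = _ := by ring
  exact le_of_sq_le_sq hfin (by positivity)

/-! ### Sum rules in a basis of eigenvectors -/

section SumRules

variable {H : Type*} [NormedAddCommGroup H] [InnerProductSpace ℝ H]

theorem HilbertBasis.hasSum_inner_sq_real {ι : Type*} (b : HilbertBasis ι ℝ H) (x : H) :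
    HasSum (fun j => inner ℝ x (b j) ^ 2) (‖x‖ ^ 2) := by
  have := b.hasSum_inner_mul_inner x x
  rw [real_inner_self_eq_norm_sq] at this
  refine this.congr_fun ?_
  intro j
  rw [real_inner_comm x (b j), sq]

theorem HilbertBasis.hasSum_inner_mul_inner_real {ι : Type*} (b : HilbertBasis ι ℝ H) (x y : H) :
    HasSum (fun j => inner ℝ x (b j) * inner ℝ y (b j)) (inner ℝ x y) := by
  have := b.hasSum_inner_mul_inner x y
  refine this.congr_fun ?_
  intro j
  rw [real_inner_comm y (b j)]

/-- The Harrell–Stubbe form of Yang's inequality for a family of commutators. -/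
theorem sum_sq_le_of_commutator (b : HilbertBasis ℕ ℝ H) {l : ℕ → ℝ} (hl : Monotone l)
    {w z : ℕ → H} (hw : ∀ i j, inner ℝ (w i) (b j) = inner ℝ (w j) (b i))
    (hz : ∀ i j, inner ℝ (z i) (b j) = (l j - l i) * inner ℝ (w i) (b j))
    (h1 : ∀ i, inner ℝ (w i) (z i) = 1) (k : ℕ) :
    ∑ i ∈ Finset.range k, (l k - l i) ^ 2 ≤ ∑ i ∈ Finset.range k, (l k - l i) * ‖z i‖ ^ 2 := by
  -- Antisymmetric in `i`, `j` by the symmetry `hw`, so the block `i, j < k` sums to zero; for `i <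
  -- k ≤ j` the sign of `l k - l j` makes each term nonpositive.
  set f : ℕ → ℕ → ℝ := fun i j =>
    (l k - l i) * (l k - l j) * (l j - l i) * inner ℝ (w i) (b j) ^ 2 with hf
  have hsum : ∀ i, HasSum (f i) ((l k - l i) ^ 2 - (l k - l i) * ‖z i‖ ^ 2) := by
    intro i
    have e1 := (b.hasSum_inner_mul_inner_real (w i) (z i)).mul_left ((l k - l i) ^ 2)
    have e2 := (b.hasSum_inner_sq_real (z i)).mul_left (l k - l i)
    rw [h1, mul_one] at e1
    refine (e1.sub e2).congr_fun fun j => ?_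
    simp only [hf, hz]
    ring
  have htot := hasSum_sum (s := Finset.range k) fun i _ => hsum i
  have hle : ∑ i ∈ Finset.range k, ((l k - l i) ^ 2 - (l k - l i) * ‖z i‖ ^ 2) ≤
      ∑ j ∈ Finset.range k, ∑ i ∈ Finset.range k, f i j := by
    have h := sum_le_hasSum (Finset.range k) (f := fun j => -∑ i ∈ Finset.range k, f i j)
      (fun j hj => ?_) htot.neg
    · simpa only [Finset.sum_neg_distrib, neg_le_neg_iff] using h
    · rw [Finset.mem_range, not_lt] at hj
      rw [neg_nonneg]
      refine Finset.sum_nonpos fun i hi => ?_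
      have hi' : i ≤ k := (Finset.mem_range.1 hi).le
      have a1 : 0 ≤ l k - l i := sub_nonneg.2 (hl hi')
      have a2 : 0 ≤ l j - l k := sub_nonneg.2 (hl hj)
      have a3 : 0 ≤ l j - l i := by linarith
      have := mul_nonneg (mul_nonneg (mul_nonneg a1 a2) a3) (sq_nonneg (inner ℝ (w i) (b j)))
      simp only [hf]
      linarith
  have hzero : ∑ j ∈ Finset.range k, ∑ i ∈ Finset.range k, f i j = 0 := by
    have h1 : ∑ j ∈ Finset.range k, ∑ i ∈ Finset.range k, f i j =
        -∑ j ∈ Finset.range k, ∑ i ∈ Finset.range k, f i j := by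
      conv_rhs => rw [Finset.sum_comm]
      simp only [← Finset.sum_neg_distrib]
      refine Finset.sum_congr rfl fun j _ => Finset.sum_congr rfl fun i _ => ?_
      simp only [hf, hw j i]
      ring
    linarith
  rw [hzero, Finset.sum_sub_distrib] at hle
  linarith

/-- No term of the spectral expansion lies strictly between two consecutive eigenvalues. -/
theorem consecutive_quadratic_nonneg (b : HilbertBasis ℕ ℝ H) {l : ℕ → ℝ} (hl : Monotone l)
    {w z : H} {c : ℝ} (hz : ∀ j, inner ℝ z (b j) = (l j - c) * inner ℝ w (b j)) (k : ℕ) :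
    0 ≤ ‖z‖ ^ 2 - ((l k - c) + (l (k + 1) - c)) * inner ℝ w z +
      (l k - c) * (l (k + 1) - c) * ‖w‖ ^ 2 := by
  have e1 := b.hasSum_inner_sq_real z
  have e2 := (b.hasSum_inner_mul_inner_real w z).mul_left ((l k - c) + (l (k + 1) - c))
  have e3 := (b.hasSum_inner_sq_real w).mul_left ((l k - c) * (l (k + 1) - c))
  refine ((e1.sub e2).add e3).nonneg fun j => ?_
  have : inner ℝ z (b j) ^ 2 - (l k - c + (l (k + 1) - c)) * (inner ℝ w (b j) * inner ℝ z (b j)) +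
      (l k - c) * (l (k + 1) - c) * inner ℝ w (b j) ^ 2 =
      (l j - l k) * (l j - l (k + 1)) * inner ℝ w (b j) ^ 2 := by
    rw [hz]; ring
  rw [this]
  refine mul_nonneg ?_ (sq_nonneg _)
  rcases Nat.lt_or_ge k j with h | h
  · exact mul_nonneg (sub_nonneg.2 (hl h.le)) (sub_nonneg.2 (hl h))
  · exact mul_nonneg_of_nonpos_of_nonpos (sub_nonpos.2 (hl h)) (sub_nonpos.2 (hl (h.trans k.le_succ)))

end SumRules

/-- Optimising the parameter in the quadratic inequality between consecutive eigenvalues. -/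
theorem sqrt_sub_sqrt_sq_le {A B c : ℝ} (hA : 0 ≤ A) (hAB : A ≤ B)
    (h : ∀ t : ℝ, 0 < t → (A + B) * t ≤ c * t + t ^ 2 + A * B) :
    (√B - √A) ^ 2 ≤ c := by
  have hB := hA.trans hAB
  have hexp : (√B - √A) ^ 2 = A + B - 2 * (√A * √B) := by
    rw [sub_sq, Real.sq_sqrt hA, Real.sq_sqrt hB]; ring
  rw [hexp]
  rcases hA.eq_or_lt with rfl | hA0
  · refine le_of_forall_pos_le_add fun t ht => ?_
    have h1 := h t ht
    have : B ≤ c + t := le_of_mul_le_mul_right (by nlinarith) ht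
    simpa using this
  · have ht : 0 < √A * √B := mul_pos (Real.sqrt_pos.2 hA0) (Real.sqrt_pos.2 (hA0.trans_le hAB))
    have h1 := h _ ht
    have h2 : A * B = (√A * √B) ^ 2 := by
      rw [mul_pow, Real.sq_sqrt hA, Real.sq_sqrt hB]
    refine le_of_mul_le_mul_right (a := √A * √B) ?_ ht
    rw [h2] at h1
    linarith

theorem sub_le_of_sqrt_sub_sqrt_sq_le {A B c : ℝ} (hA : 0 ≤ A) (hAB : A ≤ B)
    (h : (√B - √A) ^ 2 ≤ c) : B - A ≤ 2 * √(c * B) := by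
  have hB := hA.trans hAB
  have hc : 0 ≤ c := (sq_nonneg _).trans h
  have h1 : √B - √A ≤ √c := Real.le_sqrt_of_sq_le h
  have h2 : √A ≤ √B := Real.sqrt_le_sqrt hAB
  have h3 : B - A = (√B - √A) * (√B + √A) := by
    linear_combination -(Real.sq_sqrt hB) + Real.sq_sqrt hA
  rw [h3, Real.sqrt_mul hc]
  calc (√B - √A) * (√B + √A) ≤ √c * (√B + √A) :=
        mul_le_mul_of_nonneg_right h1 (by positivity)
    _ ≤ √c * (√B + √B) := mul_le_mul_of_nonneg_left (by linarith) (by positivity)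
    _ = _ := by ring

/-! ### Monotone enumeration -/

/-- A function with finite sublevel sets on an infinite type can be enumerated monotonically. -/
theorem exists_equiv_monotone_of_finite_sublevel {ι : Type*} [Infinite ι] (f : ι → ℝ)
    (hf : ∀ M : ℝ, {i | f i ≤ M}.Finite) : ∃ e : ℕ ≃ ι, Monotone (f ∘ e) := by
  classical
  have hcount : Countable ι := by
    have : (⋃ N : ℕ, {i | f i ≤ N}) = Set.univ := by
      ext i
      simpa using exists_nat_ge (f i)
    exact Set.countable_univ_iff.1 (this ▸ Set.countable_iUnion fun N => (hf N).countable)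
  obtain ⟨c, hc⟩ := hcount.exists_injective_nat
  -- Ties in `f` are broken by an injection into `ℕ`. The resulting linear order has finite initial
  -- segments and no maximum, hence is isomorphic to `ℕ`.
  let key : ι → ℝ ×ₗ ℕ := fun i => toLex (f i, c i)
  have hkey : Function.Injective key := fun i j h => hc (by
    have := congrArg (fun p => (ofLex p).2) h
    exact this)
  let : LinearOrder ι := LinearOrder.lift' key hkey
  have hle : ∀ i j : ι, i ≤ j → f i ≤ f j := by
    intro i j hij
    have : key i ≤ key j := hij
    rw [Prod.Lex.le_iff] at this
    rcases this with h | h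
    · exact h.le
    · exact h.1.le
  have hIic : ∀ j : ι, (Set.Iic j).Finite := fun j =>
    (hf (f j)).subset fun i hi => hle i j hi
  let : LocallyFiniteOrder ι := LocallyFiniteOrder.ofFiniteIcc fun i j =>
    (hIic j).subset Set.Icc_subset_Iic_self
  obtain ⟨i0⟩ : Nonempty ι := inferInstance
  obtain ⟨m, -, hm⟩ : ∃ m ∈ Set.Iic i0, ∀ x ∈ Set.Iic i0, m ≤ x :=
    Set.exists_min_image (Set.Iic i0) id (hIic i0) ⟨i0, Set.mem_Iic.2 le_rfl⟩
  let : OrderBot ι :=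
    { bot := m
      bot_le := fun a => by
        rcases le_total a i0 with h | h
        · exact hm a h
        · exact (hm i0 (Set.mem_Iic.2 le_rfl)).trans h }
  have : NoMaxOrder ι := ⟨fun a => by
    by_contra! h
    exact Set.infinite_univ ((hIic a).subset fun x _ => h x)⟩
  let : SuccOrder ι := LinearLocallyFiniteOrder.succOrder ι
  let : PredOrder ι := LinearLocallyFiniteOrder.predOrder ι
  let e : ι ≃o ℕ := orderIsoNatOfLinearSuccPredArch
  exact ⟨e.symm.toEquiv, fun a b hab => hle _ _ (e.symm.monotone hab)⟩

/-! ### A Rellich-type inequality -/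

theorem eLpNorm_two_sq_eq_lintegral {α F : Type*} [MeasurableSpace α] [NormedAddCommGroup F]
    (f : α → F) (μ : Measure α) : eLpNorm f 2 μ ^ 2 = ∫⁻ x, ‖f x‖ₑ ^ 2 ∂μ := by
  have := eLpNorm_nnreal_pow_eq_lintegral (f := f) (μ := μ) (p := 2) two_ne_zero
  simpa using this

theorem ENNReal.add_sq_le_two_mul (a b : ENNReal) : (a + b) ^ 2 ≤ 2 * (a ^ 2 + b ^ 2) := by
  have h := ENNReal.rpow_add_le_mul_rpow_add_rpow a b (p := 2) one_le_two
  have h2 : (2 : ℝ) - 1 = 1 := by norm_num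
  simpa [h2] using h

theorem enorm_integral_sq_le {α F : Type*} [MeasurableSpace α] [NormedAddCommGroup F]
    [NormedSpace ℝ F] {μ : Measure α} [IsProbabilityMeasure μ] {f : α → F}
    (hf : AEStronglyMeasurable f μ) : ‖∫ x, f x ∂μ‖ₑ ^ 2 ≤ ∫⁻ x, ‖f x‖ₑ ^ 2 ∂μ := by
  rw [← eLpNorm_two_sq_eq_lintegral]
  refine pow_le_pow_left' ?_ 2
  refine (enorm_integral_le_lintegral_enorm f).trans ?_
  rw [← eLpNorm_one_eq_lintegral_enorm]
  exact eLpNorm_le_eLpNorm_of_exponent_le (by norm_num) hf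

section Translation

variable {E : Type*} [NormedAddCommGroup E] [InnerProductSpace ℝ E] [FiniteDimensional ℝ E]
  [MeasurableSpace E] [BorelSpace E]

/-- Write the increment as the integral of the derivative along the segment, apply Jensen, exchange
the integrals and use translation invariance. -/
theorem lintegral_enorm_translate_sub_sq_le (μ : Measure E) [μ.IsAddHaarMeasure] {φ : E → ℝ}
    (hφ : ContDiff ℝ 1 φ) (z : E) :
    ∫⁻ x, ‖φ (x + z) - φ x‖ₑ ^ 2 ∂μ ≤ ‖z‖ₑ ^ 2 * ∫⁻ x, ‖fderiv ℝ φ x‖ₑ ^ 2 ∂μ := by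
  have hc : Continuous (fderiv ℝ φ) := hφ.continuous_fderiv one_ne_zero
  have hpt : ∀ x, ‖φ (x + z) - φ x‖ₑ ^ 2 ≤
      ∫⁻ t in Set.Icc (0 : ℝ) 1, ‖z‖ₑ ^ 2 * ‖fderiv ℝ φ (x + t • z)‖ₑ ^ 2 := by
    intro x
    have hcl : Continuous fun t : ℝ => fderiv ℝ φ (x + t • z) z := by fun_prop
    have hftc : φ (x + z) - φ x = ∫ t in Set.Icc (0 : ℝ) 1, fderiv ℝ φ (x + t • z) z := by
      rw [integral_Icc_eq_integral_Ioc, ← intervalIntegral.integral_of_le zero_le_one]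
      rw [intervalIntegral.integral_eq_sub_of_hasDerivAt (f := fun t : ℝ => φ (x + t • z))
        (fun t _ => ?_) (hcl.intervalIntegrable _ _)]
      · simp
      · have h1 : HasDerivAt (fun t : ℝ => x + t • z) z t := by
          simpa using ((hasDerivAt_id t).smul_const z).const_add x
        exact ((hφ.differentiable one_ne_zero _).hasFDerivAt).comp_hasDerivAt t h1
    have : IsProbabilityMeasure (volume.restrict (Set.Icc (0 : ℝ) 1)) := ⟨by simp⟩
    rw [hftc]
    refine (enorm_integral_sq_le hcl.aestronglyMeasurable).trans ?_
    refine lintegral_mono fun t => ?_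
    rw [← mul_pow, mul_comm]
    exact pow_le_pow_left' ((fderiv ℝ φ (x + t • z)).le_opENorm z) 2
  have hm : Measurable (Function.uncurry fun (x : E) (t : ℝ) =>
      ‖z‖ₑ ^ 2 * ‖fderiv ℝ φ (x + t • z)‖ₑ ^ 2) := by
    have : Continuous (fun p : E × ℝ => fderiv ℝ φ (p.1 + p.2 • z)) := by fun_prop
    exact (this.measurable.enorm.pow_const 2).const_mul _
  calc ∫⁻ x, ‖φ (x + z) - φ x‖ₑ ^ 2 ∂μ
      ≤ ∫⁻ x, ∫⁻ t in Set.Icc (0 : ℝ) 1, ‖z‖ₑ ^ 2 * ‖fderiv ℝ φ (x + t • z)‖ₑ ^ 2 ∂volume ∂μ :=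
        lintegral_mono hpt
    _ = ∫⁻ t in Set.Icc (0 : ℝ) 1, ∫⁻ x, ‖z‖ₑ ^ 2 * ‖fderiv ℝ φ (x + t • z)‖ₑ ^ 2 ∂μ :=
        lintegral_lintegral_swap hm.aemeasurable
    _ = ∫⁻ t in Set.Icc (0 : ℝ) 1, ‖z‖ₑ ^ 2 * ∫⁻ x, ‖fderiv ℝ φ x‖ₑ ^ 2 ∂μ := by
        refine lintegral_congr fun t => ?_
        rw [lintegral_const_mul' _ _ (by simp),
          lintegral_add_right_eq_self (fun x => ‖fderiv ℝ φ x‖ₑ ^ 2)]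
    _ = _ := by simp

theorem lintegral_ball_translate_sub_sq_le (μ : Measure E) [μ.IsAddHaarMeasure] {φ : E → ℝ}
    (hφ : ContDiff ℝ 1 φ) (r : ℝ) :
    ∫⁻ x, ∫⁻ y in Metric.ball x r, ‖φ x - φ y‖ₑ ^ 2 ∂μ ∂μ ≤
      μ (Metric.ball 0 r) * (ENNReal.ofReal r ^ 2 * ∫⁻ x, ‖fderiv ℝ φ x‖ₑ ^ 2 ∂μ) := by
  have h1 : ∀ x, ∫⁻ y in Metric.ball x r, ‖φ x - φ y‖ₑ ^ 2 ∂μ =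
      ∫⁻ z in Metric.ball 0 r, ‖φ (x + z) - φ x‖ₑ ^ 2 ∂μ := by
    intro x
    rw [← lintegral_indicator Metric.isOpen_ball.measurableSet,
      ← lintegral_indicator Metric.isOpen_ball.measurableSet,
      ← lintegral_add_left_eq_self _ x]
    refine lintegral_congr fun z => ?_
    simp only [Set.indicator, Metric.mem_ball, dist_zero_right, dist_self_add_left]
    rw [← enorm_neg, neg_sub]
  have hm : Measurable (Function.uncurry fun (x z : E) => ‖φ (x + z) - φ x‖ₑ ^ 2) := by
    have : Continuous fun p : E × E => φ (p.1 + p.2) - φ p.1 := by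
      have := hφ.continuous
      fun_prop
    exact this.measurable.enorm.pow_const 2
  simp_rw [h1]
  rw [lintegral_lintegral_swap hm.aemeasurable]
  calc ∫⁻ z in Metric.ball 0 r, ∫⁻ x, ‖φ (x + z) - φ x‖ₑ ^ 2 ∂μ ∂μ
      ≤ ∫⁻ z in Metric.ball 0 r, ENNReal.ofReal r ^ 2 * ∫⁻ x, ‖fderiv ℝ φ x‖ₑ ^ 2 ∂μ ∂μ := by
        refine setLIntegral_mono' Metric.isOpen_ball.measurableSet fun z hz => ?_
        refine (lintegral_enorm_translate_sub_sq_le μ hφ z).trans ?_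
        gcongr
        rw [← ofReal_norm]
        exact ENNReal.ofReal_le_ofReal (by simpa using (Metric.mem_ball.1 hz).le)
    _ = _ := by rw [setLIntegral_const, mul_comm]

/-- Deviation from the mean over a small ball, controlled by the oscillation on a larger one. -/
theorem enorm_sub_average_sq_le (μ : Measure E) [μ.IsAddHaarMeasure] {φ : E → ℝ}
    (hφ : Continuous φ) {δ : ℝ} (hδ : 0 < δ) {x c : E} (hx : x ∈ Metric.ball c δ) :
    ‖φ x - ⨍ y in Metric.ball c δ, φ y ∂μ‖ₑ ^ 2 ≤
      (μ (Metric.ball 0 δ))⁻¹ * ∫⁻ y in Metric.ball x (2 * δ), ‖φ x - φ y‖ₑ ^ 2 ∂μ := by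
  set B := Metric.ball c δ with hB
  have hB0 : μ B ≠ 0 := (Metric.measure_ball_pos μ c hδ).ne'
  have hB1 : μ B ≠ ⊤ := measure_ball_lt_top.ne
  have hBv : μ B = μ (Metric.ball 0 δ) := Measure.addHaar_ball_center μ c δ
  have hprob : IsProbabilityMeasure ((μ B)⁻¹ • μ.restrict B) :=
    ⟨by simp [ENNReal.inv_mul_cancel hB0 hB1]⟩
  have hint : Integrable φ ((μ B)⁻¹ • μ.restrict B) := by
    refine Integrable.smul_measure ?_ (ENNReal.inv_ne_top.2 hB0)
    exact (hφ.continuousOn.integrableOn_compact (isCompact_closedBall c δ)).mono_set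
      Metric.ball_subset_closedBall
  have havg : ⨍ y in B, φ y ∂μ = ∫ y, φ y ∂((μ B)⁻¹ • μ.restrict B) := by
    rw [average, Measure.restrict_apply_univ]
  have hsub : φ x - ⨍ y in B, φ y ∂μ = ∫ y, (φ x - φ y) ∂((μ B)⁻¹ • μ.restrict B) := by
    rw [integral_sub (integrable_const _) hint, havg]
    simp
  rw [hsub]
  refine (enorm_integral_sq_le (by fun_prop)).trans ?_
  rw [lintegral_smul_measure, hBv, smul_eq_mul]
  gcongr
  intro y hy
  have h1 := Metric.mem_ball.1 hx
  have h2 := Metric.mem_ball.1 hy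
  rw [Metric.mem_ball]
  linarith [dist_triangle_right y x c]

/-- Split `φ` at each point into its deviation from the mean over a covering ball and that mean. In
the constant, `2` comes from squaring a sum, `2 ^ finrank` from the volume ratio of balls of radius
`2δ` and `δ`, and `(2δ)²` from the translation estimate. When the finitely many means vanish, only a
small multiple of the Dirichlet energy remains. -/
theorem lintegral_enorm_sq_le_of_ball_cover (μ : Measure E) [μ.IsAddHaarMeasure] {φ : E → ℝ}
    (hφ : ContDiff ℝ 1 φ) {δ : ℝ} (hδ : 0 < δ) {Ω : Set E} (hΩ : MeasurableSet Ω) {s : Finset E}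
    (hs : Ω ⊆ ⋃ c ∈ s, Metric.ball c δ) :
    ∫⁻ x in Ω, ‖φ x‖ₑ ^ 2 ∂μ ≤
      ENNReal.ofReal (2 * 2 ^ Module.finrank ℝ E * (2 * δ) ^ 2) * ∫⁻ x, ‖fderiv ℝ φ x‖ₑ ^ 2 ∂μ +
        2 * μ Ω * ∑ c ∈ s, ‖⨍ y in Metric.ball c δ, φ y ∂μ‖ₑ ^ 2 := by
  set v := μ (Metric.ball (0 : E) δ) with hv
  have hv0 : v ≠ 0 := (Metric.measure_ball_pos μ 0 hδ).ne'
  have hv1 : v ≠ ⊤ := measure_ball_lt_top.ne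
  set G : E → ENNReal := fun x => ∫⁻ y in Metric.ball x (2 * δ), ‖φ x - φ y‖ₑ ^ 2 ∂μ with hG
  set S := ∑ c ∈ s, ‖⨍ y in Metric.ball c δ, φ y ∂μ‖ₑ ^ 2 with hS
  have hpt : ∀ x ∈ Ω, ‖φ x‖ₑ ^ 2 ≤ 2 * v⁻¹ * G x + 2 * S := by
    intro x hx
    obtain ⟨c, hc, hxc⟩ : ∃ c ∈ s, x ∈ Metric.ball c δ := by simpa using hs hx
    have h1 := enorm_sub_average_sq_le μ hφ.continuous hδ hxc
    have h2 : ‖⨍ y in Metric.ball c δ, φ y ∂μ‖ₑ ^ 2 ≤ S :=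
      Finset.single_le_sum (f := fun c => ‖⨍ y in Metric.ball c δ, φ y ∂μ‖ₑ ^ 2)
        (fun _ _ => zero_le) hc
    calc ‖φ x‖ₑ ^ 2
        = ‖(φ x - ⨍ y in Metric.ball c δ, φ y ∂μ) + ⨍ y in Metric.ball c δ, φ y ∂μ‖ₑ ^ 2 := by
          rw [sub_add_cancel]
      _ ≤ (‖φ x - ⨍ y in Metric.ball c δ, φ y ∂μ‖ₑ + ‖⨍ y in Metric.ball c δ, φ y ∂μ‖ₑ) ^ 2 :=
          pow_le_pow_left' (enorm_add_le _ _) 2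
      _ ≤ 2 * (‖φ x - ⨍ y in Metric.ball c δ, φ y ∂μ‖ₑ ^ 2 +
            ‖⨍ y in Metric.ball c δ, φ y ∂μ‖ₑ ^ 2) := ENNReal.add_sq_le_two_mul _ _
      _ ≤ 2 * (v⁻¹ * G x + S) := by gcongr
      _ = _ := by ring
  have hvol : μ (Metric.ball (0 : E) (2 * δ)) = ENNReal.ofReal (2 ^ Module.finrank ℝ E) * v := by
    rw [Measure.addHaar_ball_mul_of_pos μ 0 two_pos]
  calc ∫⁻ x in Ω, ‖φ x‖ₑ ^ 2 ∂μ ≤ ∫⁻ x in Ω, (2 * v⁻¹ * G x + 2 * S) ∂μ :=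
        setLIntegral_mono' hΩ hpt
    _ = 2 * v⁻¹ * ∫⁻ x in Ω, G x ∂μ + 2 * S * μ Ω := by
        rw [lintegral_add_right _ measurable_const, setLIntegral_const,
          lintegral_const_mul' _ _ (ENNReal.mul_ne_top (by simp) (ENNReal.inv_ne_top.2 hv0))]
    _ ≤ 2 * v⁻¹ * (μ (Metric.ball (0 : E) (2 * δ)) *
          (ENNReal.ofReal (2 * δ) ^ 2 * ∫⁻ x, ‖fderiv ℝ φ x‖ₑ ^ 2 ∂μ)) + 2 * S * μ Ω := by
        gcongr
        exact (setLIntegral_le_lintegral _ _).trans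
          (lintegral_ball_translate_sub_sq_le μ hφ (2 * δ))
    _ = _ := by
        have hconst : ENNReal.ofReal (2 * 2 ^ Module.finrank ℝ E * (2 * δ) ^ 2) =
            2 * ENNReal.ofReal (2 ^ Module.finrank ℝ E) * ENNReal.ofReal (2 * δ) ^ 2 := by
          rw [ENNReal.ofReal_mul (by positivity), ENNReal.ofReal_mul zero_le_two,
            ENNReal.ofReal_pow (p := 2 * δ) (by positivity), ENNReal.ofReal_ofNat]
        rw [hvol, hconst]
        have : v⁻¹ * v = 1 := ENNReal.inv_mul_cancel hv0 hv1
        calc _ = (v⁻¹ * v) * (2 * ENNReal.ofReal (2 ^ Module.finrank ℝ E) *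
              ENNReal.ofReal (2 * δ) ^ 2 * ∫⁻ x, ‖fderiv ℝ φ x‖ₑ ^ 2 ∂μ) + 2 * μ Ω * S := by ring
          _ = _ := by rw [this, one_mul]

end Translation

/-- An operator that is small on subspaces of finite codimension is compact. -/
theorem isCompactOperator_of_small_on_finite_codim {V H : Type*} [NormedAddCommGroup V]
    [InnerProductSpace ℝ V] [CompleteSpace V] [NormedAddCommGroup H] [InnerProductSpace ℝ H]
    [CompleteSpace H] (A : V →L[ℝ] H)
    (h : ∀ ε > 0, ∃ s : Finset H, ∀ x, (∀ e ∈ s, inner ℝ e (A x) = 0) → ‖A x‖ ≤ ε * ‖x‖) :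
    IsCompactOperator A := by
  refine (isClosed_setOfPred_isCompactOperator (𝕜₁ := ℝ) (𝕜₂ := ℝ) (σ₁₂ := RingHom.id ℝ)
    (M₁ := V) (M₂ := H)).closure_subset ?_
  rw [Metric.mem_closure_iff]
  intro ε hε
  obtain ⟨s, hs⟩ := h (ε / 2) (half_pos hε)
  classical
  -- Vectors orthogonal to `K` are exactly those whose image under `A` is orthogonal to `s`, so
  -- composing `A` with the projection onto `K` gives a finite-rank operator within `ε / 2` of `A`.
  set K : Submodule ℝ V := Submodule.span ℝ (s.image (ContinuousLinearMap.adjoint A) : Set V)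
  have hK : FiniteDimensional ℝ K := FiniteDimensional.span_finset ℝ _
  refine ⟨A ∘L K.starProjection, ?_, ?_⟩
  · have h1 : IsCompactOperator (id : K → K) := isCompactOperator_id
    have h2 := (h1.clm_comp K.subtypeL).clm_comp A
    exact h2.comp_clm K.orthogonalProjectionOnto
  · rw [dist_eq_norm]
    refine (ContinuousLinearMap.opNorm_le_bound _ (half_pos hε).le fun x => ?_).trans_lt
      (half_lt_self hε)
    have h1 : (A - A ∘L K.starProjection) x = A (x - K.starProjection x) := by simp
    rw [h1]
    refine (hs _ fun e he => ?_).trans ?_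
    · rw [← ContinuousLinearMap.adjoint_inner_left, real_inner_comm]
      exact Submodule.starProjection_inner_eq_zero x _
        (Submodule.subset_span (by simpa using ⟨e, he, rfl⟩))
    · gcongr
      have : x - K.starProjection x = Kᗮ.starProjection x := by
        rw [Submodule.starProjection_orthogonal']; simp
      rw [this]
      simpa using Kᗮ.starProjection.le_of_opNorm_le (Submodule.starProjection_norm_le Kᗮ) x

/-! ### Eigenbasis of a closed quadratic form with compact embedding -/

section Spectral

variable {H : Type*} [NormedAddCommGroup H] [InnerProductSpace ℝ H]

/-- Images of distinct such eigenvectors are at distance at least `c` by orthogonality, so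
infinitely many would have no convergent subsequence. -/
theorem finite_setOf_eigenvalue_ge {T : H →L[ℝ] H} (hT : IsCompactOperator T) {ι : Type*}
    {v : ι → H} (hv : Orthonormal ℝ v) {m : ι → ℝ} (hm : ∀ i, T (v i) = m i • v i) {c : ℝ}
    (hc : 0 < c) : {i | c ≤ m i}.Finite := by
  by_contra hinf
  have hinf' : Set.Infinite {i | c ≤ m i} := hinf
  set j : ℕ ↪ {i | c ≤ m i} := hinf'.natEmbedding
  obtain ⟨a, -, φ, hφ, hlim⟩ := (hT.isCompact_closure_image_closedBall 1).tendsto_subseq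
    (x := fun k => T (v (j k))) fun k => subset_closure ⟨v (j k), by simp [hv.1], rfl⟩
  obtain ⟨N, hN⟩ := Metric.cauchySeq_iff'.1 hlim.cauchySeq c hc
  have h1 := hN (N + 1) (Nat.le_succ N)
  have hne : (j (φ (N + 1)) : ι) ≠ j (φ N) := fun h =>
    (hφ (Nat.lt_succ_self N)).ne' (j.injective (Subtype.ext h))
  have h2 : ‖T (v (j (φ (N + 1)))) - T (v (j (φ N)))‖ ^ 2 =
      m (j (φ (N + 1))) ^ 2 + m (j (φ N)) ^ 2 := by
    rw [hm, hm, @norm_sub_sq_real, real_inner_smul_left, real_inner_smul_right, hv.2 hne,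
      norm_smul, norm_smul, hv.1, hv.1]
    simp
  have h3 : c ^ 2 ≤ ‖T (v (j (φ (N + 1)))) - T (v (j (φ N)))‖ ^ 2 := by
    rw [h2]
    have := pow_le_pow_left₀ hc.le (j (φ (N + 1))).2 2
    have := sq_nonneg (m (j (φ N)))
    linarith
  have h4 := le_of_sq_le_sq h3 (norm_nonneg _)
  rw [Function.comp_apply, Function.comp_apply, dist_eq_norm] at h1
  linarith

theorem infinite_of_orthogonal_span_eq_bot {ι : Type*} (hH : ¬ FiniteDimensional ℝ H) {v : ι → H}
    (hv : (Submodule.span ℝ (Set.range v))ᗮ = ⊥) : Infinite ι := by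
  by_contra hfin
  rw [not_infinite_iff_finite] at hfin
  have hfd : FiniteDimensional ℝ (Submodule.span ℝ (Set.range v)) :=
    FiniteDimensional.span_of_finite ℝ (Set.finite_range v)
  rw [Submodule.orthogonal_eq_bot_iff] at hv
  rw [hv] at hfd
  exact hH (LinearEquiv.finiteDimensional (Submodule.topEquiv (R := ℝ) (M := H)))

variable [CompleteSpace H]

theorem exists_orthonormal_eigenvectors {T : H →L[ℝ] H} (hT : IsCompactOperator T)
    (hs : T.IsSymmetric) (hinj : ∀ x, T x = 0 → x = 0) :
    ∃ (ι : Type) (v : ι → H) (m : ι → ℝ), Orthonormal ℝ v ∧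
      (Submodule.span ℝ (Set.range v))ᗮ = ⊥ ∧ ∀ i, T (v i) = m i • v i := by
  have hfin : ∀ μ : ℝ, FiniteDimensional ℝ (Module.End.eigenspace T.toLinearMap μ) := by
    intro μ
    by_cases hμ : μ = 0
    · have : Module.End.eigenspace T.toLinearMap μ = ⊥ := by
        rw [Submodule.eq_bot_iff]
        intro x hx
        rw [Module.End.mem_eigenspace_iff, hμ, zero_smul] at hx
        exact hinj x hx
      rw [this]
      infer_instance
    · exact ContinuousLinearMap.finite_dimensional_eigenspace hT μ hμ
  have hort := (hs.orthogonalFamily_eigenspaces).orthonormal_sigma_orthonormal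
    (v_family := fun μ => stdOrthonormalBasis ℝ (Module.End.eigenspace T.toLinearMap μ))
    fun μ => (stdOrthonormalBasis ℝ (Module.End.eigenspace T.toLinearMap μ)).orthonormal
  refine ⟨_, _, fun i => i.1, hort, ?_, ?_⟩
  · rw [eq_bot_iff, ← ContinuousLinearMap.orthogonalComplement_iSup_eigenspaces_eq_bot hT hs]
    refine Submodule.orthogonal_le (iSup_le fun μ x hx => ?_)
    have hx' := (stdOrthonormalBasis ℝ (Module.End.eigenspace T.toLinearMap μ)).sum_repr ⟨x, hx⟩
    have hx2 := congrArg Subtype.val hx'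
    rw [← show _ = x from hx2, AddSubmonoidClass.coe_finsetSum]
    refine Submodule.sum_mem _ fun i _ => ?_
    rw [Submodule.coe_smul]
    exact Submodule.smul_mem _ _ (Submodule.subset_span ⟨⟨μ, i⟩, rfl⟩)
  · rintro ⟨μ, i⟩
    exact Module.End.mem_eigenspace_iff.1
      (stdOrthonormalBasis ℝ (Module.End.eigenspace T.toLinearMap μ) i).2

variable {G : Type*} [NormedAddCommGroup G] [InnerProductSpace ℝ G] [CompleteSpace G]

/-- A closed, densely defined quadratic form with compact embedding, given as the graph of the
"gradient", has an orthonormal basis of eigenvectors with eigenvalues increasing to infinity. -/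
theorem exists_hilbertBasis_of_compact_form (hH : ¬ FiniteDimensional ℝ H)
    (V : Submodule ℝ (H × G)) (hclosed : IsClosed (V : Set (H × G)))
    (hdense : ∀ x : H, (∀ p ∈ V, inner ℝ x p.1 = 0) → x = 0)
    (hcompact : ∀ ε > 0, ∃ s : Finset H, ∀ p ∈ V, (∀ e ∈ s, inner ℝ e p.1 = 0) →
      ‖p.1‖ ≤ ε * ‖p.2‖) :
    ∃ (b : HilbertBasis ℕ ℝ H) (g : ℕ → G) (l : ℕ → ℝ), Monotone l ∧
      Filter.Tendsto l Filter.atTop Filter.atTop ∧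
      ∀ j, (b j, g j) ∈ V ∧ ∀ p ∈ V, inner ℝ (g j) p.2 = l j * inner ℝ (b j) p.1 := by
  -- The form domain with norm `‖u‖² + ‖∇u‖²`; passing from the sup norm of the product to `WithLp
  -- 2` makes it a Hilbert space.
  set W : Submodule ℝ (WithLp 2 (H × G)) :=
    V.comap (WithLp.prodContinuousLinearEquiv 2 ℝ H G).toLinearMap with hW
  have hWclosed : IsClosed (W : Set (WithLp 2 (H × G))) :=
    hclosed.preimage (WithLp.prodContinuousLinearEquiv 2 ℝ H G).continuous
  have : CompleteSpace W := hWclosed.completeSpace_coe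
  set A : W →L[ℝ] H := (WithLp.fstL 2 ℝ H G).comp W.subtypeL with hA
  have hWV : ∀ x : W, ((x : WithLp 2 (H × G)).fst, (x : WithLp 2 (H × G)).snd) ∈ V :=
    fun x => x.2
  have hAcomp : IsCompactOperator A := by
    refine isCompactOperator_of_small_on_finite_codim A fun ε hε => ?_
    obtain ⟨s, hs⟩ := hcompact ε hε
    refine ⟨s, fun x hx => (hs _ (hWV x) hx).trans ?_⟩
    gcongr
    exact WithLp.norm_snd_le _ (x : WithLp 2 (H × G))
  -- For the Dirichlet form this is the resolvent `(-Δ + 1)⁻¹`: by `hadj`, the adjoint of the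
  -- embedding solves the weak equation for `-Δ + 1`. An eigenvalue `m` of `T` therefore corresponds
  -- to the eigenvalue `m⁻¹ - 1` of the form.
  set T : H →L[ℝ] H := A.comp (ContinuousLinearMap.adjoint A) with hTdef
  have hT : IsCompactOperator T := hAcomp.comp_clm _
  have hTin : ∀ x y, inner ℝ (T x) y =
      inner ℝ (ContinuousLinearMap.adjoint A x) (ContinuousLinearMap.adjoint A y) := fun x y => by
    rw [ContinuousLinearMap.adjoint_inner_right]; rfl
  have hs : T.IsSymmetric := fun x y => by
    change inner ℝ (T x) y = inner ℝ x (T y)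
    rw [hTin, real_inner_comm (T y) x, hTin, real_inner_comm]
  have hadj : ∀ x, ∀ p ∈ V, inner ℝ (ContinuousLinearMap.adjoint A x : WithLp 2 (H × G)).fst p.1 +
      inner ℝ (ContinuousLinearMap.adjoint A x : WithLp 2 (H × G)).snd p.2 = inner ℝ x p.1 := by
    intro x p hp
    exact ContinuousLinearMap.adjoint_inner_left A ⟨WithLp.toLp 2 p, hp⟩ x
  have hadj0 : ∀ x, ContinuousLinearMap.adjoint A x = 0 → x = 0 := by
    intro x hx
    refine hdense x fun p hp => ?_
    rw [← hadj x p hp, hx]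
    simp
  have hinj : ∀ x, T x = 0 → x = 0 := by
    intro x hx
    refine hadj0 x ?_
    rw [← inner_self_eq_zero (𝕜 := ℝ), ← hTin, hx, inner_zero_left]
  obtain ⟨ι, v, m, hv, hvspan, hvm⟩ := exists_orthonormal_eigenvectors hT hs hinj
  have hmpos : ∀ i, 0 < m i := by
    intro i
    have h1 : inner ℝ (T (v i)) (v i) = m i := by
      rw [hvm, real_inner_smul_left, real_inner_self_eq_norm_sq, hv.1]; simp
    rw [← h1, hTin, real_inner_self_eq_norm_sq]
    have : ContinuousLinearMap.adjoint A (v i) ≠ 0 := fun h => hv.ne_zero i (hadj0 _ h)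
    positivity
  have := infinite_of_orthogonal_span_eq_bot hH hvspan
  have hsub : ∀ M : ℝ, {i | (m i)⁻¹ - 1 ≤ M}.Finite := by
    intro M
    have hM : 0 < |M + 1| + 1 := by positivity
    refine (finite_setOf_eigenvalue_ge hT hv hvm (inv_pos.2 hM)).subset fun i hi => ?_
    have h1 : (m i)⁻¹ ≤ |M + 1| + 1 := by
      have h2 : (m i)⁻¹ - 1 ≤ M := hi
      linarith [le_abs_self (M + 1)]
    exact inv_le_of_inv_le₀ (hmpos i) h1
  obtain ⟨e, he⟩ := exists_equiv_monotone_of_finite_sublevel (fun i => (m i)⁻¹ - 1) hsub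
  have hspan : (Submodule.span ℝ (Set.range (v ∘ e)))ᗮ = ⊥ := by
    rw [e.surjective.range_comp, hvspan]
  refine ⟨HilbertBasis.mkOfOrthogonalEqBot (hv.comp e e.injective) hspan,
    fun j => (m (e j))⁻¹ • (ContinuousLinearMap.adjoint A (v (e j)) : WithLp 2 (H × G)).snd,
    _, he, ?_, fun j => ?_⟩
  · rw [Filter.tendsto_atTop]
    intro M
    have hfin : {j : ℕ | (m (e j))⁻¹ - 1 ≤ M}.Finite := (hsub M).preimage e.injective.injOn
    have := hfin.compl_mem_cofinite
    rw [Nat.cofinite_eq_atTop] at this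
    filter_upwards [this] with j hj
    exact le_of_not_ge fun h => hj h
  · rw [HilbertBasis.coe_mkOfOrthogonalEqBot]
    set i := e j
    have hfst : (ContinuousLinearMap.adjoint A (v i) : WithLp 2 (H × G)).fst = m i • v i :=
      hvm i
    constructor
    · have h1 := V.smul_mem (m i)⁻¹ (hWV (ContinuousLinearMap.adjoint A (v i)))
      rw [hfst, Prod.smul_mk, smul_smul, inv_mul_cancel₀ (hmpos i).ne', one_smul] at h1
      exact h1
    · intro p hp
      have h1 := hadj (v i) p hp
      rw [hfst, real_inner_smul_left] at h1
      rw [real_inner_smul_left]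
      simp only [Function.comp_apply]
      have h2 := (hmpos i).ne'
      change (m i)⁻¹ * _ = ((m i)⁻¹ - 1) * inner ℝ (v i) p.1
      field_simp
      linarith

end Spectral

/-! ### The Dirichlet eigenbasis of a bounded domain -/

section Domain

variable {n : ℕ} {Ω : Set (EuclideanSpace ℝ (Fin n))}

theorem norm_gradient_eq_norm_fderiv (φ : EuclideanSpace ℝ (Fin n) → ℝ)
    (x : EuclideanSpace ℝ (Fin n)) : ‖gradient φ x‖ = ‖fderiv ℝ φ x‖ :=
  LinearIsometryEquiv.norm_map _ _

theorem enorm_Lp_sq {F : Type*} [NormedAddCommGroup F] {μ : Measure (EuclideanSpace ℝ (Fin n))}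
    (u : Lp F 2 μ) {f : EuclideanSpace ℝ (Fin n) → F} (h : u =ᵐ[μ] f) :
    ‖u‖ₑ ^ 2 = ∫⁻ x, ‖f x‖ₑ ^ 2 ∂μ := by
  rw [Lp.enorm_def, eLpNorm_congr_ae h, eLpNorm_two_sq_eq_lintegral]

theorem IsTestFunction.eq_zero_of_notMem {φ : EuclideanSpace ℝ (Fin n) → ℝ}
    (hφ : IsTestFunction Ω φ) {x : EuclideanSpace ℝ (Fin n)} (hx : x ∉ Ω) : φ x = 0 :=
  image_eq_zero_of_notMem_tsupport fun h => hx (hφ.tsupport_subset h)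

theorem IsTestFunction.fderiv_eq_zero_of_notMem {φ : EuclideanSpace ℝ (Fin n) → ℝ}
    (hφ : IsTestFunction Ω φ) {x : EuclideanSpace ℝ (Fin n)} (hx : x ∉ Ω) : fderiv ℝ φ x = 0 :=
  image_eq_zero_of_notMem_tsupport fun h =>
    hx (hφ.tsupport_subset (tsupport_fderiv_subset ℝ h))

theorem inner_indicator_ball_eq (hΩ : MeasurableSet Ω) {φ : EuclideanSpace ℝ (Fin n) → ℝ}
    (hφ : IsTestFunction Ω φ) {u : L2Scalar Ω} (hu : u =ᵐ[volume.restrict Ω] φ)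
    {s : Set (EuclideanSpace ℝ (Fin n))} (hs : MeasurableSet s)
    (hs' : (volume.restrict Ω) s ≠ ⊤) :
    inner ℝ (indicatorConstLp 2 hs hs' (1 : ℝ)) u = ∫ x in s, φ x := by
  rw [L2.inner_indicatorConstLp_one, integral_congr_ae (ae_restrict_of_ae hu),
    Measure.restrict_restrict hs, Set.inter_comm, ← Measure.restrict_restrict hΩ]
  exact setIntegral_eq_integral_of_forall_compl_eq_zero fun x hx => hφ.eq_zero_of_notMem hx

/-- The ball means of a test function are inner products with indicators, so both sides are
continuous in `L²` and the estimate can pass to the closure. -/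
theorem norm_sq_le_of_mem_testGraph (hΩ : IsBoundedDomain Ω) {δ : ℝ} (hδ : 0 < δ) :
    ∃ (K : ℝ) (s : Finset (EuclideanSpace ℝ (Fin n)))
      (e : EuclideanSpace ℝ (Fin n) → L2Scalar Ω), ∀ p ∈ testGraph Ω,
      ‖p.1‖ ^ 2 ≤ 2 * 2 ^ n * (2 * δ) ^ 2 * ‖p.2‖ ^ 2 + K * ∑ c ∈ s, inner ℝ (e c) p.1 ^ 2 := by
  have hmeas := hΩ.isOpen.measurableSet
  obtain ⟨t, -, ht, hcover⟩ := Metric.finite_approx_of_totallyBounded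
    (hΩ.isBounded.isCompact_closure.totallyBounded.subset subset_closure) δ hδ
  set v : ℝ := volume.real (Metric.ball (0 : EuclideanSpace ℝ (Fin n)) δ) with hv
  have hfin : ∀ c : EuclideanSpace ℝ (Fin n), (volume.restrict Ω) (Metric.ball c δ) ≠ ⊤ :=
    fun c => ((Measure.restrict_apply_le _ _).trans_lt measure_ball_lt_top).ne
  refine ⟨2 * volume.real Ω * (v⁻¹) ^ 2, ht.toFinset, fun c => indicatorConstLp 2
    Metric.isOpen_ball.measurableSet (hfin c) (1 : ℝ), ?_⟩
  rintro ⟨u, g⟩ ⟨φ, hφ, hu, hg⟩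
  simp only at hu hg ⊢
  have h := lintegral_enorm_sq_le_of_ball_cover volume (hφ.contDiff.of_le (by exact_mod_cast le_top))
    hδ hmeas (s := ht.toFinset) (by simpa using hcover)
  rw [← enorm_Lp_sq u hu] at h
  have h2 : ∫⁻ x, ‖fderiv ℝ φ x‖ₑ ^ 2 = ‖g‖ₑ ^ 2 := by
    rw [enorm_Lp_sq g hg]
    have : ∀ x, ‖gradient φ x‖ₑ = ‖fderiv ℝ φ x‖ₑ := fun x => by
      rw [← ofReal_norm, ← ofReal_norm, norm_gradient_eq_norm_fderiv]
    simp_rw [this]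
    refine (setLIntegral_eq_of_support_subset fun x hx => ?_).symm
    by_contra hxΩ
    refine hx ?_
    simp only [hφ.fderiv_eq_zero_of_notMem hxΩ]
    rw [← ofReal_norm, norm_zero]
    simp
  have h3 : ∀ c, ⨍ y in Metric.ball c δ, φ y = v⁻¹ * inner ℝ (indicatorConstLp 2
      Metric.isOpen_ball.measurableSet (hfin c) (1 : ℝ)) u := by
    intro c
    rw [inner_indicator_ball_eq hmeas hφ hu, setAverage_eq, smul_eq_mul, hv,
      Measure.real, Measure.real, Measure.addHaar_ball_center]
  have hvol : volume Ω ≠ ⊤ := hΩ.isBounded.measure_lt_top.ne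
  rw [h2, ← ENNReal.ofReal_toReal hvol] at h
  simp_rw [h3, ← ofReal_norm, ← ENNReal.ofReal_pow (norm_nonneg _)] at h
  have htwo : ∀ a c : ℝ, 0 ≤ a →
      (2 : ENNReal) * ENNReal.ofReal a * ENNReal.ofReal c = ENNReal.ofReal (2 * a * c) := by
    intro a c ha
    rw [ENNReal.ofReal_mul (by positivity), ENNReal.ofReal_mul zero_le_two, ENNReal.ofReal_ofNat]
  rw [← ENNReal.ofReal_sum_of_nonneg (fun _ _ => by positivity),
    ← ENNReal.ofReal_mul (by positivity), htwo _ _ ENNReal.toReal_nonneg,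
    ← ENNReal.ofReal_add (by positivity) (by positivity),
    ENNReal.ofReal_le_ofReal_iff (by positivity), finrank_euclideanSpace_fin] at h
  refine h.trans_eq ?_
  congr 1
  rw [Finset.mul_sum, Finset.mul_sum]
  refine Finset.sum_congr rfl fun c _ => ?_
  rw [Real.norm_eq_abs, sq_abs, mul_pow]
  simp only [Measure.real]
  ring

/-- Rellich compactness of `H¹₀(Ω) ⊂ L²(Ω)`: the embedding is small on subspaces of finite
codimension. -/
theorem sobolevGraph_small_on_finite_codim (hΩ : IsBoundedDomain Ω) {ε : ℝ} (hε : 0 < ε) :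
    ∃ s : Finset (L2Scalar Ω), ∀ p ∈ sobolevGraph Ω, (∀ e ∈ s, inner ℝ e p.1 = 0) →
      ‖p.1‖ ≤ ε * ‖p.2‖ := by
  classical
  -- Makes the gradient coefficient equal to `ε² / (2 · 2^n)`, which is at most `ε²`.
  set δ : ℝ := ε / (4 * 2 ^ n) with hδ
  obtain ⟨K, s, e, h⟩ := norm_sq_le_of_mem_testGraph hΩ (δ := δ) (by positivity)
  have hclosed : IsClosed {p : L2Scalar Ω × L2Vector Ω | ‖p.1‖ ^ 2 ≤
      2 * 2 ^ n * (2 * δ) ^ 2 * ‖p.2‖ ^ 2 + K * ∑ c ∈ s, inner ℝ (e c) p.1 ^ 2} := by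
    apply isClosed_le
    · fun_prop
    · fun_prop
  have hall : ∀ p ∈ sobolevGraph Ω, ‖p.1‖ ^ 2 ≤
      2 * 2 ^ n * (2 * δ) ^ 2 * ‖p.2‖ ^ 2 + K * ∑ c ∈ s, inner ℝ (e c) p.1 ^ 2 :=
    fun p hp => closure_minimal h hclosed hp
  refine ⟨s.image e, fun p hp hpe => ?_⟩
  have h1 := hall p hp
  have h2 : ∑ c ∈ s, inner ℝ (e c) p.1 ^ 2 = 0 := Finset.sum_eq_zero fun c hc => by
    rw [hpe _ (Finset.mem_image_of_mem e hc)]; simp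
  rw [h2, mul_zero, add_zero] at h1
  refine le_of_sq_le_sq (h1.trans ?_) (by positivity)
  rw [mul_pow ε]
  refine mul_le_mul_of_nonneg_right ?_ (sq_nonneg ‖p.2‖)
  have h3 : (1 : ℝ) ≤ 2 ^ n := one_le_pow₀ (one_le_two (α := ℝ))
  have h4 : 2 * 2 ^ n * (2 * δ) ^ 2 = ε ^ 2 / (2 * 2 ^ n) := by
    rw [hδ]; field_simp; ring
  rw [h4]
  exact div_le_self (by positivity) (by linarith)

theorem eq_zero_of_inner_sobolevGraph_eq_zero (hΩ : IsOpen Ω) (u : L2Scalar Ω)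
    (hu : ∀ p ∈ sobolevGraph Ω, inner ℝ u p.1 = 0) : u = 0 := by
  have h0 : ∀ᵐ x, x ∈ Ω → u x = 0 := by
    refine hΩ.ae_eq_zero_of_integral_contDiff_smul_eq_zero ?_ fun φ h1 h2 h3 => ?_
    · have h := (Lp.memLp u).locallyIntegrable one_le_two
      rw [← locallyIntegrableOn_univ] at h
      exact locallyIntegrableOn_of_locallyIntegrable_restrict (locallyIntegrableOn_univ.1 h)
    · have hφ : IsTestFunction Ω φ := ⟨h1, h2, h3⟩
      have h4 := hu (hφ.memLp.toLp, hφ.memLp_gradient.toLp)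
        ((testGraph Ω).le_topologicalClosure ⟨φ, hφ, hφ.memLp.coeFn_toLp,
          hφ.memLp_gradient.coeFn_toLp⟩)
      rw [L2.inner_def] at h4
      have h5 : ∫ x in Ω, φ x • u x = 0 := by
        rw [← h4]
        refine integral_congr_ae ?_
        filter_upwards [hφ.memLp.coeFn_toLp] with x hx
        simp [hx]
      rw [← h5]
      refine (setIntegral_eq_integral_of_forall_compl_eq_zero fun x hx => ?_).symm
      simp [hφ.eq_zero_of_notMem hx]
  refine (Lp.eq_zero_iff_ae_eq_zero).2 ?_
  rw [Filter.EventuallyEq, ae_restrict_iff' hΩ.measurableSet]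
  exact h0

/-- Infinitely many disjoint nonempty open subsets have orthogonal nonzero indicators. Positive
dimension matters: for `n = 0` the domain is a point. -/
theorem not_finiteDimensional_L2Scalar (hn : 1 ≤ n) (hΩ : IsBoundedDomain Ω) :
    ¬ FiniteDimensional ℝ (L2Scalar Ω) := by
  intro hfd
  have : Nonempty (Fin n) := ⟨⟨0, hn⟩⟩
  have : Infinite Ω := by
    obtain ⟨x, hx⟩ := hΩ.isConnected.nonempty
    exact (infinite_of_mem_nhds x (hΩ.isOpen.mem_nhds hx)).to_subtype
  obtain ⟨U, hUinf, hUo, hUd⟩ := exists_seq_infinite_isOpen_pairwise_disjoint Ω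
  set S : ℕ → Set (EuclideanSpace ℝ (Fin n)) := fun k => Subtype.val '' U k with hS
  have hSo : ∀ k, IsOpen (S k) := fun k => hΩ.isOpen.isOpenMap_subtype_val _ (hUo k)
  have hSΩ : ∀ k, S k ⊆ Ω := fun k => by rintro _ ⟨x, -, rfl⟩; exact x.2
  have hSd : ∀ i j, i ≠ j → Disjoint (S i) (S j) := fun i j hij =>
    (Set.disjoint_image_iff Subtype.val_injective).2 (hUd hij)
  have hfin : ∀ k, (volume.restrict Ω) (S k) ≠ ⊤ := fun k =>
    ((measure_mono (Set.subset_univ _)).trans_lt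
      (by simpa using hΩ.isBounded.measure_lt_top)).ne
  have hpos : ∀ k, (volume.restrict Ω) (S k) ≠ 0 := fun k => by
    rw [Measure.restrict_apply (hSo k).measurableSet, Set.inter_eq_left.2 (hSΩ k)]
    exact ((hSo k).measure_pos volume ((hUinf k).nonempty.image _)).ne'
  set f : ℕ → L2Scalar Ω := fun k =>
    indicatorConstLp 2 (hSo k).measurableSet (hfin k) (1 : ℝ) with hf
  have hin : ∀ i j, inner ℝ (f i) (f j) = (volume.restrict Ω).real (S i ∩ S j) := fun i j => by
    rw [hf, L2.real_inner_indicatorConstLp_one_indicatorConstLp_one (hSo i).measurableSet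
      (hSo j).measurableSet (hfin i) (hfin j)]
  have hli : LinearIndependent ℝ f := by
    refine linearIndependent_of_ne_zero_of_inner_eq_zero (𝕜 := ℝ) (fun k h => ?_) fun i j hij => ?_
    · have := hin k k
      rw [h, inner_zero_left, Set.inter_self, Measure.real, eq_comm,
        ENNReal.toReal_eq_zero_iff] at this
      exact this.elim (hpos k) (hfin k)
    · change inner ℝ (f i) (f j) = 0
      rw [hin, (hSd i j hij).inter_eq]; simp
  have := hli.finite
  exact not_finite ℕ

theorem exists_dirichlet_eigenbasis (hn : 1 ≤ n) (hΩ : IsBoundedDomain Ω) :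
    ∃ (b : HilbertBasis ℕ ℝ (L2Scalar Ω)) (g : ℕ → L2Vector Ω) (l : ℕ → ℝ), Monotone l ∧
      Filter.Tendsto l Filter.atTop Filter.atTop ∧
      ∀ j, (b j, g j) ∈ sobolevGraph Ω ∧
        ∀ p ∈ sobolevGraph Ω, inner ℝ (g j) p.2 = l j * inner ℝ (b j) p.1 :=
  exists_hilbertBasis_of_compact_form (not_finiteDimensional_L2Scalar hn hΩ) (sobolevGraph Ω)
    (Submodule.isClosed_topologicalClosure _)
    (eq_zero_of_inner_sobolevGraph_eq_zero hΩ.isOpen)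
    fun _ hε => sobolevGraph_small_on_finite_codim hΩ hε

end Domain

/-! ### Identification of the enumerated eigenvalues -/

section Eigenvalues

variable {n : ℕ} {Ω : Set (EuclideanSpace ℝ (Fin n))}

theorem inner_eq_integral_mul_of_ae_eq (u : L2Scalar Ω) {v : L2Scalar Ω}
    {φ : EuclideanSpace ℝ (Fin n) → ℝ} (h : v =ᵐ[volume.restrict Ω] φ) :
    inner ℝ u v = ∫ x in Ω, u x * φ x := by
  rw [L2.inner_def]
  refine integral_congr_ae ?_
  filter_upwards [h] with x hx
  simp [hx, mul_comm]

theorem inner_eq_integral_inner_of_ae_eq (g : L2Vector Ω) {h : L2Vector Ω}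
    {G : EuclideanSpace ℝ (Fin n) → EuclideanSpace ℝ (Fin n)}
    (hG : h =ᵐ[volume.restrict Ω] G) :
    inner ℝ g h = ∫ x in Ω, inner ℝ (g x) (G x) := by
  rw [L2.inner_def]
  refine integral_congr_ae ?_
  filter_upwards [hG] with x hx
  rw [hx]

/-- Both sides of the weak equation are continuous in the tested pair, so test functions may be
replaced by arbitrary elements of `H¹₀`, in particular by other eigenfunctions. -/
theorem mem_dirichletEigenspace_iff {ν : ℝ} {u : L2Scalar Ω} :
    u ∈ dirichletEigenspace Ω ν ↔ ∃ g : L2Vector Ω, (u, g) ∈ sobolevGraph Ω ∧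
      ∀ p ∈ sobolevGraph Ω, inner ℝ g p.2 = ν * inner ℝ u p.1 := by
  constructor
  · rintro ⟨g, hg, h⟩
    refine ⟨g, hg, fun p hp => ?_⟩
    have hcl : IsClosed {p : L2Scalar Ω × L2Vector Ω | inner ℝ g p.2 = ν * inner ℝ u p.1} :=
      isClosed_eq (by fun_prop) (by fun_prop)
    refine closure_minimal (fun q hq => ?_) hcl hp
    obtain ⟨φ, hφ, h1, h2⟩ := hq
    change inner ℝ g q.2 = ν * inner ℝ u q.1
    rw [inner_eq_integral_mul_of_ae_eq u h1, inner_eq_integral_inner_of_ae_eq g h2, h φ hφ]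
  · rintro ⟨g, hg, h⟩
    refine ⟨g, hg, fun φ hφ => ?_⟩
    have h1 := h (hφ.memLp.toLp, hφ.memLp_gradient.toLp)
      ((testGraph Ω).le_topologicalClosure ⟨φ, hφ, hφ.memLp.coeFn_toLp,
        hφ.memLp_gradient.coeFn_toLp⟩)
    rwa [inner_eq_integral_mul_of_ae_eq u hφ.memLp.coeFn_toLp,
      inner_eq_integral_inner_of_ae_eq g hφ.memLp_gradient.coeFn_toLp] at h1

variable {b : HilbertBasis ℕ ℝ (L2Scalar Ω)} {g : ℕ → L2Vector Ω} {l : ℕ → ℝ}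

/-- Testing two eigenfunctions against each other shows that one with eigenvalue `ν` is orthogonal
to every `b j` with `l j ≠ ν`; its expansion is then a finite sum, since `l` tends to infinity. -/
theorem iSup_dirichletEigenspace_eq_span
    (hl : Filter.Tendsto l Filter.atTop Filter.atTop)
    (hb : ∀ j, (b j, g j) ∈ sobolevGraph Ω ∧
      ∀ p ∈ sobolevGraph Ω, inner ℝ (g j) p.2 = l j * inner ℝ (b j) p.1) (μ : ℝ) :
    ⨆ ν : ℝ, ⨆ _ : ν ≤ μ, dirichletEigenspace Ω ν = Submodule.span ℝ (b '' {j | l j ≤ μ}) := by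
  apply le_antisymm
  · refine iSup_le fun ν => iSup_le fun hν u hu => ?_
    obtain ⟨h, hV, hweak⟩ := mem_dirichletEigenspace_iff.1 hu
    have horth : ∀ j, (ν - l j) * inner ℝ (b j) u = 0 := by
      intro j
      have h1 := hweak _ (hb j).1
      have h2 := (hb j).2 _ hV
      simp only at h1 h2
      rw [real_inner_comm, h2, real_inner_comm (b j) u] at h1
      rw [sub_mul]
      linarith
    have hfin : {j | l j ≤ μ}.Finite := by
      have := hl.eventually_gt_atTop μ
      rw [← Nat.cofinite_eq_atTop] at this
      exact this.subset fun j hj h => not_lt.2 (show l j ≤ μ from hj) h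
    have hsum := b.hasSum_repr u
    have hfs : HasSum (fun j => b.repr u j • b j) (∑ j ∈ hfin.toFinset, b.repr u j • b j) := by
      refine hasSum_sum_of_ne_finset_zero fun j hj => ?_
      rw [Set.Finite.mem_toFinset, Set.mem_ofPred, not_le] at hj
      have : inner ℝ (b j) u = 0 :=
        (mul_eq_zero.1 (horth j)).resolve_left (by linarith)
      rw [b.repr_apply_apply, this, zero_smul]
    rw [hsum.unique hfs]
    refine Submodule.sum_mem _ fun j hj => Submodule.smul_mem _ _ (Submodule.subset_span ?_)
    exact ⟨j, hfin.mem_toFinset.1 hj, rfl⟩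
  · rw [Submodule.span_le]
    rintro _ ⟨j, hj, rfl⟩
    refine Submodule.mem_iSup_of_mem (l j) (Submodule.mem_iSup_of_mem hj ?_)
    exact mem_dirichletEigenspace_iff.2 ⟨g j, hb j⟩

/-- The rank in the definition counts the `j` with `l j ≤ μ`. By monotonicity these form an initial
segment, which has at least `k + 1` elements exactly when `l k ≤ μ`. -/
theorem dirichletEigenvalue_succ_eq (hmono : Monotone l)
    (hl : Filter.Tendsto l Filter.atTop Filter.atTop)
    (hb : ∀ j, (b j, g j) ∈ sobolevGraph Ω ∧
      ∀ p ∈ sobolevGraph Ω, inner ℝ (g j) p.2 = l j * inner ℝ (b j) p.1) (k : ℕ) :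
    dirichletEigenvalue Ω (k + 1) = l k := by
  have hmk : ∀ m : ℕ, Cardinal.mk ((Finset.range m : Set ℕ)) = m := fun m => by simp
  have hset : {μ : ℝ | ((k + 1 : ℕ) : Cardinal) ≤
      Module.rank ℝ ↥(⨆ ν : ℝ, ⨆ _ : ν ≤ μ, dirichletEigenspace Ω ν)} = Set.Ici (l k) := by
    ext μ
    have hli : LinearIndepOn ℝ id (b '' {j | l j ≤ μ}) :=
      (b.orthonormal.linearIndependent.linearIndepOn _).id_image
    rw [Set.mem_ofPred, Set.mem_Ici, iSup_dirichletEigenspace_eq_span hl hb, rank_span_set hli,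
      Cardinal.mk_image_eq b.orthonormal.linearIndependent.injective]
    constructor
    · intro h
      by_contra! hlt
      have hsub : {j | l j ≤ μ} ⊆ (Finset.range k : Set ℕ) := by
        intro j hj
        rw [Finset.coe_range, Set.mem_Iio]
        by_contra! hkj
        exact absurd (hmono hkj) (not_le.2 (lt_of_le_of_lt hj hlt))
      have h1 := h.trans (Cardinal.mk_le_mk_of_subset hsub)
      rw [hmk, Nat.cast_le] at h1
      omega
    · intro h
      have hsub : (Finset.range (k + 1) : Set ℕ) ⊆ {j | l j ≤ μ} := by
        intro j hj
        rw [Finset.coe_range, Set.mem_Iio] at hj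
        exact (hmono (Nat.lt_succ_iff.1 hj)).trans h
      have h1 := Cardinal.mk_le_mk_of_subset hsub
      rwa [hmk] at h1
  rw [dirichletEigenvalue, hset, csInf_Ici]

end Eigenvalues

/-! ### Multiplication by functions of a coordinate and partial derivatives -/

section Multiplication

variable {n : ℕ} {Ω : Set (EuclideanSpace ℝ (Fin n))}

theorem memLp_top_comp_coord (hΩ : IsBoundedDomain Ω) (p : Fin n) {F : ℝ → ℝ}
    (hF : Continuous F) :
    MemLp (fun x : EuclideanSpace ℝ (Fin n) => F (x p)) ⊤ (volume.restrict Ω) := by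
  have hc : Continuous fun x : EuclideanSpace ℝ (Fin n) => F (x p) := by fun_prop
  obtain ⟨C, hC⟩ := hΩ.isBounded.isCompact_closure.exists_bound_of_continuousOn hc.continuousOn
  refine memLp_top_of_bound hc.aestronglyMeasurable C ?_
  rw [ae_restrict_iff' hΩ.isOpen.measurableSet]
  exact Filter.Eventually.of_forall fun x hx => hC x (subset_closure hx)

variable {E : Type*} [NormedAddCommGroup E] [NormedSpace ℝ E]

/-- Multiplication by `F (x p)` as an operator on `L²(Ω)`. -/
noncomputable def coordMul (hΩ : IsBoundedDomain Ω) (p : Fin n) (F : ℝ → ℝ) (hF : Continuous F) :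
    Lp E 2 (volume.restrict Ω) →L[ℝ] Lp E 2 (volume.restrict Ω) :=
  (ContinuousLinearMap.lsmul ℝ ℝ : ℝ →L[ℝ] E →L[ℝ] E).holderL (volume.restrict Ω) ⊤ 2 2
    (memLp_top_comp_coord hΩ p hF).toLp

theorem coeFn_coordMul (hΩ : IsBoundedDomain Ω) (p : Fin n) {F : ℝ → ℝ} (hF : Continuous F)
    (u : Lp E 2 (volume.restrict Ω)) :
    coordMul hΩ p F hF u =ᵐ[volume.restrict Ω] fun x => F (x p) • u x := by
  filter_upwards [(ContinuousLinearMap.lsmul ℝ ℝ : ℝ →L[ℝ] E →L[ℝ] E).coeFn_holder (r := 2)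
    (memLp_top_comp_coord hΩ p hF).toLp u, (memLp_top_comp_coord hΩ p hF).coeFn_toLp] with x h1 h2
  rw [coordMul, ContinuousLinearMap.holderL_apply_apply, h1, h2]
  simp

theorem coordMul_comp (hΩ : IsBoundedDomain Ω) (p : Fin n) {F K : ℝ → ℝ} (hF : Continuous F)
    (hK : Continuous K) (u : Lp E 2 (volume.restrict Ω)) :
    coordMul hΩ p F hF (coordMul hΩ p K hK u) =
      coordMul hΩ p (fun t => F t * K t) (hF.mul hK) u := by
  apply Lp.ext
  filter_upwards [coeFn_coordMul hΩ p hF (coordMul hΩ p K hK u), coeFn_coordMul hΩ p hK u,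
    coeFn_coordMul hΩ p (F := fun t => F t * K t) (hF.mul hK) u] with x h1 h2 h3
  rw [h1, h2, h3, smul_smul]

theorem coordMul_const_mul (hΩ : IsBoundedDomain Ω) (p : Fin n) (c : ℝ) {F : ℝ → ℝ}
    (hF : Continuous F) (u : Lp E 2 (volume.restrict Ω)) :
    coordMul hΩ p (fun t => c * F t) (continuous_const.mul hF) u = c • coordMul hΩ p F hF u := by
  apply Lp.ext
  filter_upwards [coeFn_coordMul hΩ p (F := fun t => c * F t) (continuous_const.mul hF) u,
    coeFn_coordMul hΩ p hF u,
    Lp.coeFn_smul c (coordMul hΩ p F hF u)] with x h1 h2 h3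
  rw [h1, h3, Pi.smul_apply, h2, smul_smul]

theorem coordMul_add (hΩ : IsBoundedDomain Ω) (p : Fin n) {F K : ℝ → ℝ} (hF : Continuous F)
    (hK : Continuous K) (u : Lp E 2 (volume.restrict Ω)) :
    coordMul hΩ p (fun t => F t + K t) (hF.add hK) u = coordMul hΩ p F hF u +
      coordMul hΩ p K hK u := by
  apply Lp.ext
  filter_upwards [coeFn_coordMul hΩ p (F := fun t => F t + K t) (hF.add hK) u,
    coeFn_coordMul hΩ p hF u,
    coeFn_coordMul hΩ p hK u, Lp.coeFn_add (coordMul hΩ p F hF u) (coordMul hΩ p K hK u)]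
    with x h1 h2 h3 h4
  rw [h1, h4, Pi.add_apply, h2, h3, add_smul]

theorem coordMul_one (hΩ : IsBoundedDomain Ω) (p : Fin n) (u : Lp E 2 (volume.restrict Ω)) :
    coordMul hΩ p (fun _ => 1) continuous_const u = u := by
  apply Lp.ext
  filter_upwards [coeFn_coordMul hΩ p (continuous_const (y := (1 : ℝ))) u] with x h1
  rw [h1, one_smul]

theorem inner_coordMul_left {E : Type*} [NormedAddCommGroup E] [InnerProductSpace ℝ E]
    (hΩ : IsBoundedDomain Ω) (p : Fin n) {F : ℝ → ℝ} (hF : Continuous F)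
    (u v : Lp E 2 (volume.restrict Ω)) :
    inner ℝ (coordMul hΩ p F hF u) v = inner ℝ u (coordMul hΩ p F hF v) := by
  rw [L2.inner_def, L2.inner_def]
  refine integral_congr_ae ?_
  filter_upwards [coeFn_coordMul hΩ p hF u, coeFn_coordMul hΩ p hF v] with x h1 h2
  rw [h1, h2, real_inner_smul_left, real_inner_smul_right]

/-- The `p`-th component of a vector field. -/
noncomputable def componentL (Ω : Set (EuclideanSpace ℝ (Fin n))) (p : Fin n) :
    L2Vector Ω →L[ℝ] L2Scalar Ω :=
  (EuclideanSpace.proj p : EuclideanSpace ℝ (Fin n) →L[ℝ] ℝ).compLpL 2 (volume.restrict Ω)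

/-- The vector field with `p`-th component `u` and other components zero. -/
noncomputable def axisL (Ω : Set (EuclideanSpace ℝ (Fin n))) (p : Fin n) :
    L2Scalar Ω →L[ℝ] L2Vector Ω :=
  (ContinuousLinearMap.toSpanSingleton ℝ (EuclideanSpace.single p (1 : ℝ))).compLpL 2
    (volume.restrict Ω)

theorem coeFn_componentL (p : Fin n) (g : L2Vector Ω) :
    componentL Ω p g =ᵐ[volume.restrict Ω] fun x => g x p :=
  ContinuousLinearMap.coeFn_compLpL _ g

theorem coeFn_axisL (p : Fin n) (u : L2Scalar Ω) :
    axisL Ω p u =ᵐ[volume.restrict Ω] fun x => u x • EuclideanSpace.single p (1 : ℝ) :=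
  ContinuousLinearMap.coeFn_compLpL _ u

theorem componentL_axisL (p : Fin n) (u : L2Scalar Ω) : componentL Ω p (axisL Ω p u) = u := by
  apply Lp.ext
  filter_upwards [coeFn_componentL p (axisL Ω p u), coeFn_axisL p u] with x h1 h2
  rw [h1, h2]
  simp

theorem inner_axisL (p : Fin n) (g : L2Vector Ω) (u : L2Scalar Ω) :
    inner ℝ g (axisL Ω p u) = inner ℝ (componentL Ω p g) u := by
  rw [L2.inner_def, L2.inner_def]
  refine integral_congr_ae ?_
  filter_upwards [coeFn_componentL p g, coeFn_axisL p u] with x h1 h2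
  rw [h1, h2, real_inner_smul_right, EuclideanSpace.inner_single_right]
  simp

theorem componentL_coordMul (hΩ : IsBoundedDomain Ω) (p q : Fin n) {F : ℝ → ℝ}
    (hF : Continuous F) (g : L2Vector Ω) :
    componentL Ω q (coordMul hΩ p F hF g) = coordMul hΩ p F hF (componentL Ω q g) := by
  apply Lp.ext
  filter_upwards [coeFn_componentL q (coordMul hΩ p F hF g), coeFn_coordMul hΩ p hF g,
    coeFn_coordMul hΩ p hF (componentL Ω q g), coeFn_componentL q g] with x h1 h2 h3 h4
  rw [h1, h2, h3, h4]
  simp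

theorem sum_norm_componentL_sq (g : L2Vector Ω) :
    ∑ p, ‖componentL Ω p g‖ ^ 2 = ‖g‖ ^ 2 := by
  simp_rw [← real_inner_self_eq_norm_sq, L2.inner_def]
  rw [← integral_finsetSum _ fun p _ => L2.integrable_inner (𝕜 := ℝ) _ _]
  refine integral_congr_ae ?_
  have h : ∀ᵐ x ∂(volume.restrict Ω), ∀ p, componentL Ω p g x = g x p :=
    ae_all_iff.2 fun p => coeFn_componentL p g
  filter_upwards [h] with x hx
  rw [real_inner_self_eq_norm_sq, EuclideanSpace.norm_sq_eq]
  refine Finset.sum_congr rfl fun p _ => ?_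
  rw [hx, real_inner_self_eq_norm_sq]

theorem gradient_apply_coord (φ : EuclideanSpace ℝ (Fin n) → ℝ) (x : EuclideanSpace ℝ (Fin n))
    (p : Fin n) : gradient φ x p = fderiv ℝ φ x (EuclideanSpace.single p 1) := by
  rw [← inner_gradient_left, EuclideanSpace.inner_single_right]
  simp

theorem IsTestFunction.coord_mul {φ : EuclideanSpace ℝ (Fin n) → ℝ} (hφ : IsTestFunction Ω φ)
    (p : Fin n) {F : ℝ → ℝ} (hF : ContDiff ℝ (⊤ : ℕ∞) F) :
    IsTestFunction Ω fun x => F (x p) * φ x :=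
  ⟨(hF.comp (by fun_prop)).mul hφ.contDiff, hφ.hasCompactSupport.mul_left,
    (tsupport_mul_subset_right (f := fun x : EuclideanSpace ℝ (Fin n) => F (x p))
      (g := φ)).trans hφ.tsupport_subset⟩

theorem IsTestFunction.gradient_coord_mul {φ : EuclideanSpace ℝ (Fin n) → ℝ}
    (hφ : IsTestFunction Ω φ) (p : Fin n) {F F' : ℝ → ℝ} (hF : ∀ t, HasDerivAt F (F' t) t)
    (x : EuclideanSpace ℝ (Fin n)) :
    gradient (fun x => F (x p) * φ x) x =
      F (x p) • gradient φ x + (F' (x p) * φ x) • EuclideanSpace.single p 1 := by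
  have h1 : HasFDerivAt (fun x : EuclideanSpace ℝ (Fin n) => F (x p))
      (F' (x p) • (EuclideanSpace.proj p : EuclideanSpace ℝ (Fin n) →L[ℝ] ℝ)) x :=
    (hF (x p)).comp_hasFDerivAt x
      (EuclideanSpace.proj p : EuclideanSpace ℝ (Fin n) →L[ℝ] ℝ).hasFDerivAt
  have h2 : HasFDerivAt (fun x : EuclideanSpace ℝ (Fin n) => F (x p) * φ x) _ x :=
    h1.mul (hφ.differentiable x).hasFDerivAt
  refine ext_inner_right ℝ fun y => ?_
  rw [inner_gradient_left, h2.fderiv, inner_add_left,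
    real_inner_smul_left, real_inner_smul_left, inner_gradient_left,
    EuclideanSpace.inner_single_left]
  simp
  ring

/-- `H¹₀(Ω)` is stable under multiplication by smooth functions of a coordinate. -/
theorem coordMul_mem_sobolevGraph (hΩ : IsBoundedDomain Ω) (p : Fin n) {F F' : ℝ → ℝ}
    (hF : ContDiff ℝ (⊤ : ℕ∞) F) (hF' : Continuous F') (hd : ∀ t, HasDerivAt F (F' t) t)
    {q : L2Scalar Ω × L2Vector Ω} (hq : q ∈ sobolevGraph Ω) :
    (coordMul hΩ p F hF.continuous q.1, coordMul hΩ p F hF.continuous q.2 +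
      axisL Ω p (coordMul hΩ p F' hF' q.1)) ∈ sobolevGraph Ω := by
  refine map_mem_closure (t := (testGraph Ω : Set (L2Scalar Ω × L2Vector Ω)))
    (f := fun q : L2Scalar Ω × L2Vector Ω => (coordMul hΩ p F hF.continuous q.1,
      coordMul hΩ p F hF.continuous q.2 + axisL Ω p (coordMul hΩ p F' hF' q.1)))
    (by fun_prop) hq ?_
  rintro ⟨u, g⟩ ⟨φ, hφ, h1, h2⟩
  refine ⟨_, hφ.coord_mul p hF, ?_, ?_⟩
  · filter_upwards [coeFn_coordMul hΩ p hF.continuous u, h1] with x h3 h4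
    simp only [h3, h4, smul_eq_mul]
  · filter_upwards [coeFn_coordMul hΩ p hF.continuous g, coeFn_coordMul hΩ p hF' u, h1, h2,
      coeFn_axisL p (coordMul hΩ p F' hF' u), Lp.coeFn_add (coordMul hΩ p F hF.continuous g)
        (axisL Ω p (coordMul hΩ p F' hF' u))] with x h3 h4 h5 h6 h7 h8
    rw [h8, Pi.add_apply, h3, h7, h4, h5, h6, hφ.gradient_coord_mul p hd, smul_eq_mul]

/-- Integration by parts in `H¹₀(Ω)`. -/
theorem inner_componentL_add_eq_zero (p : Fin n)
    {q r : L2Scalar Ω × L2Vector Ω} (hq : q ∈ sobolevGraph Ω) (hr : r ∈ sobolevGraph Ω) :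
    inner ℝ q.1 (componentL Ω p r.2) + inner ℝ (componentL Ω p q.2) r.1 = 0 := by
  -- The identity is classical for test functions and is extended by closure in one argument at a
  -- time.
  have htest : ∀ q ∈ testGraph Ω, ∀ r ∈ testGraph Ω,
      inner ℝ q.1 (componentL Ω p r.2) + inner ℝ (componentL Ω p q.2) r.1 = 0 := by
    rintro ⟨u, g⟩ ⟨φ, hφ, h1, h2⟩ ⟨v, h⟩ ⟨ψ, hψ, h3, h4⟩
    simp only at h1 h2 h3 h4 ⊢
    set e : EuclideanSpace ℝ (Fin n) := EuclideanSpace.single p 1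
    have i1 : inner ℝ u (componentL Ω p h) = ∫ x, φ x * fderiv ℝ ψ x e := by
      rw [L2.inner_def, ← setIntegral_eq_integral_of_forall_compl_eq_zero (s := Ω)
        (f := fun x => φ x * fderiv ℝ ψ x e) fun x hx => by rw [hφ.eq_zero_of_notMem hx, zero_mul]]
      refine integral_congr_ae ?_
      filter_upwards [h1, h4, coeFn_componentL p h] with x a1 a2 a3
      rw [a1, a3, a2, gradient_apply_coord]
      simp [e, mul_comm]
    have i2 : inner ℝ (componentL Ω p g) v = ∫ x, fderiv ℝ φ x e * ψ x := by
      rw [L2.inner_def, ← setIntegral_eq_integral_of_forall_compl_eq_zero (s := Ω)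
        (f := fun x => fderiv ℝ φ x e * ψ x) fun x hx => by rw [hψ.eq_zero_of_notMem hx, mul_zero]]
      refine integral_congr_ae ?_
      filter_upwards [h2, h3, coeFn_componentL p g] with x a1 a2 a3
      rw [a3, a1, a2, gradient_apply_coord]
      simp [e, mul_comm]
    have c1 : ∀ {χ : EuclideanSpace ℝ (Fin n) → ℝ}, IsTestFunction Ω χ →
        Continuous fun x => fderiv ℝ χ x e := fun hχ => by
      have := hχ.contDiff.continuous_fderiv (by simp)
      fun_prop
    have hint : ∀ {f : EuclideanSpace ℝ (Fin n) → ℝ}, Continuous f → HasCompactSupport f →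
        Integrable f := fun h1 h2 => h1.integrable_of_hasCompactSupport h2
    rw [i1, i2, integral_mul_fderiv_eq_neg_fderiv_mul_of_integrable
      (hint ((c1 hφ).mul hψ.contDiff.continuous) hψ.hasCompactSupport.mul_left)
      (hint (hφ.contDiff.continuous.mul (c1 hψ)) hφ.hasCompactSupport.mul_right)
      (hint (hφ.contDiff.continuous.mul hψ.contDiff.continuous) hψ.hasCompactSupport.mul_left)
      (fun x _ => hφ.differentiable x) (fun x _ => hψ.differentiable x)]
    exact neg_add_cancel _
  have hq' : ∀ r ∈ testGraph Ω,
      inner ℝ q.1 (componentL Ω p r.2) + inner ℝ (componentL Ω p q.2) r.1 = 0 := fun r hr =>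
    closure_minimal (s := (testGraph Ω : Set (L2Scalar Ω × L2Vector Ω)))
      (t := {q | inner ℝ q.1 (componentL Ω p r.2) + inner ℝ (componentL Ω p q.2) r.1 = 0})
      (fun q hq => htest q hq r hr) (isClosed_eq (by fun_prop) (by fun_prop)) hq
  exact closure_minimal (s := (testGraph Ω : Set (L2Scalar Ω × L2Vector Ω)))
    (t := {r | inner ℝ q.1 (componentL Ω p r.2) + inner ℝ (componentL Ω p q.2) r.1 = 0})
    hq' (isClosed_eq (by fun_prop) (by fun_prop)) hr

end Multiplication

/-! ### Commutators with functions of a coordinate -/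

section Commutator

variable {n : ℕ} {Ω : Set (EuclideanSpace ℝ (Fin n))}

/-- The weak form of `(-Δ - κ) (f u) = -2 f' ∂_p u - f'' u` for an eigenfunction `u` with
eigenvalue `κ` and a function `f` of the coordinate `x p`, tested with an eigenfunction `v`. -/
theorem inner_commutator (hΩ : IsBoundedDomain Ω) (p : Fin n) {F F' F'' : ℝ → ℝ}
    (hF : ContDiff ℝ (⊤ : ℕ∞) F) (hF' : ContDiff ℝ (⊤ : ℕ∞) F') (hF'' : Continuous F'')
    (hd : ∀ t, HasDerivAt F (F' t) t) (hd' : ∀ t, HasDerivAt F' (F'' t) t)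
    {u v : L2Scalar Ω} {g h : L2Vector Ω} {κ ν : ℝ} (hu : (u, g) ∈ sobolevGraph Ω)
    (hv : (v, h) ∈ sobolevGraph Ω)
    (hgu : ∀ q ∈ sobolevGraph Ω, inner ℝ g q.2 = κ * inner ℝ u q.1)
    (hhv : ∀ q ∈ sobolevGraph Ω, inner ℝ h q.2 = ν * inner ℝ v q.1) :
    inner ℝ ((-2 : ℝ) • coordMul hΩ p F' hF'.continuous (componentL Ω p g) -
      coordMul hΩ p F'' hF'' u) v = (ν - κ) * inner ℝ (coordMul hΩ p F hF.continuous u) v := by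
  -- Three identities: the equation of `v` tested with `f u`, that of `u` tested with `f v`, and
  -- integration by parts of `f' u` against `v`. The terms `f ∇u · ∇v` cancel in the combination, so
  -- no second derivatives of `u` are needed.
  have h1 := hhv _ (coordMul_mem_sobolevGraph hΩ p hF hF'.continuous hd hu)
  have h2 := hgu _ (coordMul_mem_sobolevGraph hΩ p hF hF'.continuous hd hv)
  have h3 := inner_componentL_add_eq_zero p
    (coordMul_mem_sobolevGraph hΩ p hF' hF'' hd' hu) hv
  simp only at h1 h2 h3
  rw [inner_add_right, inner_axisL, real_inner_comm (coordMul hΩ p F hF.continuous u) v] at h1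
  rw [inner_add_right, inner_axisL, ← inner_coordMul_left hΩ p hF.continuous u v,
    ← inner_coordMul_left hΩ p hF.continuous g h,
    ← inner_coordMul_left hΩ p hF'.continuous _ v] at h2
  rw [map_add, componentL_axisL, componentL_coordMul, inner_add_left] at h3
  rw [real_inner_comm (coordMul hΩ p F hF.continuous g) h,
    real_inner_comm (coordMul hΩ p F' hF'.continuous u) (componentL Ω p h)] at h1
  rw [inner_sub_left, real_inner_smul_left]
  linear_combination h1 - h2 - h3

/-- The canonical commutation relation: integrate `∂_p (x_p u²) = u² + 2 x_p u ∂_p u`. It normalises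
the sum rule, and also shows that an eigenfunction with zero gradient would vanish, whence `λ₁ > 0`.
-/
theorem inner_coord_mul_componentL (hΩ : IsBoundedDomain Ω) (p : Fin n) {u : L2Scalar Ω}
    {g : L2Vector Ω} (hu : (u, g) ∈ sobolevGraph Ω) :
    inner ℝ (coordMul hΩ p (fun t => t) continuous_id u) ((-2 : ℝ) • componentL Ω p g) =
      ‖u‖ ^ 2 := by
  have h3 := inner_componentL_add_eq_zero p (coordMul_mem_sobolevGraph hΩ p (F := fun t => t)
    (F' := fun _ => 1) contDiff_id continuous_const (fun t => hasDerivAt_id t) hu) hu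
  simp only at h3
  rw [map_add, componentL_axisL, componentL_coordMul, inner_add_left, coordMul_one,
    inner_coordMul_left hΩ p _ (componentL Ω p g) u, real_inner_self_eq_norm_sq] at h3
  rw [real_inner_comm _ (componentL Ω p g)] at h3
  rw [real_inner_smul_right]
  linarith

/-- The eigenvalues of the Dirichlet problem satisfy Yang's inequality, and consecutive ones are
separated by at most `4 √(λ₁ λ_{k+1} / n)`. -/
theorem dirichletEigenvalue_inequalities (hn : 1 ≤ n) (hΩ : IsBoundedDomain Ω) :
    ∃ l : ℕ → ℝ, (∀ k, dirichletEigenvalue Ω (k + 1) = l k) ∧ 0 < l 0 ∧ Monotone l ∧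
      (∀ k : ℕ, ∑ i ∈ Finset.range k, (l k - l i) ^ 2 ≤
        4 / n * ∑ i ∈ Finset.range k, (l k - l i) * l i) ∧
      ∀ k : ℕ, l (k + 1) - l k ≤ 4 * √(l 0 * l (k + 1) / n) := by
  obtain ⟨b, g, l, hmono, htend, hb⟩ := exists_dirichlet_eigenbasis hn hΩ
  have hn0 : (0 : ℝ) < n := by exact_mod_cast hn
  have hbn : ∀ j, ‖b j‖ = 1 := fun j => b.orthonormal.1 j
  have hg : ∀ j, ‖g j‖ ^ 2 = l j := fun j => by
    have := (hb j).2 _ (hb j).1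
    simpa [hbn] using this
  have hl0 : 0 < l 0 := by
    rw [← hg 0]
    have : g 0 ≠ 0 := by
      intro h0
      have h1 := inner_coord_mul_componentL hΩ ⟨0, hn⟩ (hb 0).1
      rw [h0, map_zero (componentL Ω ⟨0, hn⟩), smul_zero, inner_zero_right, hbn] at h1
      norm_num at h1
    positivity
  refine ⟨l, dirichletEigenvalue_succ_eq hmono htend hb, hl0, hmono, fun k => ?_, fun k => ?_⟩
  · have hp : ∀ p : Fin n, ∑ i ∈ Finset.range k, (l k - l i) ^ 2 ≤
        ∑ i ∈ Finset.range k, (l k - l i) * (4 * ‖componentL Ω p (g i)‖ ^ 2) := by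
      intro p
      have h := sum_sq_le_of_commutator b hmono
        (w := fun i => coordMul hΩ p (fun t => t) continuous_id (b i))
        (z := fun i => (-2 : ℝ) • componentL Ω p (g i))
        (fun i j => by rw [inner_coordMul_left, real_inner_comm])
        (fun i j => by
          -- The zero second derivative is written `0 * 1` so that `coordMul_const_mul` can remove
          -- its term.
          have hc := inner_commutator hΩ p (F := fun t => t) (F' := fun _ => 1)
            (F'' := fun _ => 0 * 1) contDiff_id contDiff_const continuous_const
            (fun t => hasDerivAt_id t)
            (fun t => by rw [zero_mul]; exact hasDerivAt_const t 1) (hb i).1 (hb j).1 (hb i).2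
            (hb j).2
          rw [coordMul_one, coordMul_const_mul hΩ p 0 continuous_const, zero_smul, sub_zero] at hc
          exact hc)
        (fun i => by rw [inner_coord_mul_componentL hΩ p (hb i).1, hbn, one_pow]) k
      refine h.trans_eq (Finset.sum_congr rfl fun i _ => ?_)
      rw [norm_smul, mul_pow]
      norm_num
    have hsum := Finset.sum_le_sum fun p (_ : p ∈ Finset.univ) => hp p
    rw [Finset.sum_const, Finset.card_univ, Fintype.card_fin, nsmul_eq_mul,
      Finset.sum_comm] at hsum
    have h2 : ∑ i ∈ Finset.range k, ∑ p, (l k - l i) * (4 * ‖componentL Ω p (g i)‖ ^ 2) =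
        4 * ∑ i ∈ Finset.range k, (l k - l i) * l i := by
      rw [Finset.mul_sum]
      refine Finset.sum_congr rfl fun i _ => ?_
      rw [← Finset.mul_sum, ← Finset.mul_sum, sum_norm_componentL_sq, hg]
      ring
    rw [h2] at hsum
    rw [div_mul_eq_mul_div, le_div_iff₀ hn0, mul_comm]
    exact hsum
  · set A := l k - l 0 with hA
    set B := l (k + 1) - l 0 with hB
    have hA0 : 0 ≤ A := sub_nonneg.2 (hmono (Nat.zero_le k))
    have hAB : A ≤ B := sub_le_sub_right (hmono k.le_succ) _
    -- The real form of testing with `exp (i α x_p) u_0`. Adding the cosine and sine inequalities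
    -- removes the mixed terms by `hcross`, and `sin² + cos² = 1` collapses the others to `‖∂_p
    -- u_0‖²` and `‖u_0‖² = 1`.
    have hp : ∀ (α : ℝ) (p : Fin n), (A + B) * α ^ 2 ≤
        4 * α ^ 2 * ‖componentL Ω p (g 0)‖ ^ 2 + (α ^ 2) ^ 2 + A * B := by
      intro α p
      have hlin : ∀ t : ℝ, HasDerivAt (fun t : ℝ => α * t) α t := fun t => by
        simpa using (hasDerivAt_id t).const_mul α
      have hsmooth : ContDiff ℝ (⊤ : ℕ∞) fun t : ℝ => α * t := by fun_prop
      have hS : ContDiff ℝ (⊤ : ℕ∞) fun t : ℝ => Real.sin (α * t) := hsmooth.sin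
      have hC : ContDiff ℝ (⊤ : ℕ∞) fun t : ℝ => Real.cos (α * t) := hsmooth.cos
      have dS : ∀ t, HasDerivAt (fun t : ℝ => Real.sin (α * t)) (α * Real.cos (α * t)) t :=
        fun t => by simpa [mul_comm] using (hlin t).sin
      have dC : ∀ t, HasDerivAt (fun t : ℝ => Real.cos (α * t)) (-α * Real.sin (α * t)) t :=
        fun t => by simpa [mul_comm] using (hlin t).cos
      have dS' : ∀ t, HasDerivAt (fun t : ℝ => α * Real.cos (α * t))
          (-α ^ 2 * Real.sin (α * t)) t := fun t => by
        convert! (dC t).const_mul α using 1; ring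
      have dC' : ∀ t, HasDerivAt (fun t : ℝ => -α * Real.sin (α * t))
          (-α ^ 2 * Real.cos (α * t)) t := fun t => by
        convert! (dS t).const_mul (-α) using 1; ring
      set S : L2Scalar Ω →L[ℝ] L2Scalar Ω := coordMul hΩ p _ hS.continuous with hSdef
      set C : L2Scalar Ω →L[ℝ] L2Scalar Ω := coordMul hΩ p _ hC.continuous with hCdef
      set u := b 0
      set v := componentL Ω p (g 0)
      have hSS : ∀ x y, inner ℝ (S x) y = inner ℝ x (S y) :=
        inner_coordMul_left hΩ p hS.continuous
      have hCC : ∀ x y, inner ℝ (C x) y = inner ℝ x (C y) :=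
        inner_coordMul_left hΩ p hC.continuous
      have hcomm : ∀ x, S (C x) = C (S x) := fun x => by
        rw [hSdef, hCdef, coordMul_comp, coordMul_comp]
        simp_rw [mul_comm]
      have hpyth : ∀ x, ‖S x‖ ^ 2 + ‖C x‖ ^ 2 = ‖x‖ ^ 2 := fun x => by
        rw [← real_inner_self_eq_norm_sq, ← real_inner_self_eq_norm_sq, hSS, hCC,
          ← inner_add_right, hSdef, hCdef, coordMul_comp, coordMul_comp, ← coordMul_add]
        have : (fun t : ℝ => Real.sin (α * t) * Real.sin (α * t) +
            Real.cos (α * t) * Real.cos (α * t)) = fun _ => 1 := by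
          funext t; rw [← sq, ← sq, Real.sin_sq_add_cos_sq]
        simp_rw [this]
        rw [coordMul_one, real_inner_self_eq_norm_sq]
      have hcross : inner ℝ (S v) (C u) = inner ℝ (C v) (S u) := by
        rw [hSS, hCC, hcomm]
      have cC : ∀ j, inner ℝ ((2 * α) • S v + α ^ 2 • C u) (b j) =
          (l j - l 0) * inner ℝ (C u) (b j) := fun j => by
        have hc := inner_commutator hΩ p (F'' := fun t => -α ^ 2 * Real.cos (α * t)) hC
          (contDiff_const.mul hS) (continuous_const.mul hC.continuous) dC dC' (hb 0).1 (hb j).1 (hb 0).2 (hb j).2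
        rw [coordMul_const_mul hΩ p (-α) hS.continuous,
          coordMul_const_mul hΩ p (-α ^ 2) hC.continuous] at hc
        rw [← hc]
        congr 1
        module
      have cS : ∀ j, inner ℝ (-(2 * α) • C v + α ^ 2 • S u) (b j) =
          (l j - l 0) * inner ℝ (S u) (b j) := fun j => by
        have hc := inner_commutator hΩ p (F'' := fun t => -α ^ 2 * Real.sin (α * t)) hS
          (contDiff_const.mul hC) (continuous_const.mul hS.continuous) dS dS' (hb 0).1 (hb j).1 (hb 0).2 (hb j).2
        rw [coordMul_const_mul hΩ p α hC.continuous,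
          coordMul_const_mul hΩ p (-α ^ 2) hS.continuous] at hc
        rw [← hc]
        congr 1
        module
      have q1 := consecutive_quadratic_nonneg b hmono cC k
      have q2 := consecutive_quadratic_nonneg b hmono cS k
      rw [inner_add_right, real_inner_smul_right, real_inner_smul_right,
        real_inner_self_eq_norm_sq, @norm_add_sq_real, norm_smul, norm_smul, mul_pow, mul_pow,
        real_inner_smul_left, real_inner_smul_right, Real.norm_eq_abs, Real.norm_eq_abs, sq_abs,
        sq_abs] at q1 q2
      rw [real_inner_comm (S v) (C u)] at q1
      rw [real_inner_comm (C v) (S u)] at q2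
      rw [hcross] at q1
      have e1 := hpyth u
      have e2 := hpyth v
      rw [hbn, one_pow] at e1
      have hsu : ‖S u‖ ^ 2 = 1 - ‖C u‖ ^ 2 := by linarith
      have hsv : ‖S v‖ ^ 2 = ‖v‖ ^ 2 - ‖C v‖ ^ 2 := by linarith
      rw [hsv] at q1
      rw [hsu] at q2
      have := add_nonneg q1 q2
      simp only [← hA, ← hB] at this
      linarith
    -- Take `α = √t` and average over the `n` coordinates; the squared components of the gradient of
    -- `u_0` sum to `l 0`.
    have hsq : (√B - √A) ^ 2 ≤ 4 * l 0 / n := by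
      refine sqrt_sub_sqrt_sq_le hA0 hAB fun t ht => ?_
      have hsum := Finset.sum_le_sum fun p (_ : p ∈ Finset.univ) => hp (√t) p
      simp only [Real.sq_sqrt ht.le, Finset.sum_add_distrib, Finset.sum_const, Finset.card_univ,
        Fintype.card_fin, nsmul_eq_mul, ← Finset.mul_sum, sum_norm_componentL_sq, hg] at hsum
      refine le_of_mul_le_mul_left (hsum.trans_eq ?_) hn0
      field_simp
    have h1 := sub_le_of_sqrt_sub_sqrt_sq_le hA0 hAB hsq
    have h2 : 4 * l 0 / n * B ≤ 2 ^ 2 * (l 0 * l (k + 1) / n) := by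
      have : 2 ^ 2 * (l 0 * l (k + 1) / n) - 4 * l 0 / n * B = 4 * l 0 ^ 2 / n := by
        rw [hB]; ring
      have h3 : 0 ≤ 4 * l 0 ^ 2 / n := by positivity
      linarith
    have h3 := Real.sqrt_le_sqrt h2
    rw [Real.sqrt_mul (x := 2 ^ 2) (by positivity), Real.sqrt_sq zero_le_two] at h3
    calc l (k + 1) - l k = B - A := by rw [hA, hB]; ring
      _ ≤ 2 * √(4 * l 0 / n * B) := h1
      _ ≤ 2 * (2 * √(l 0 * l (k + 1) / n)) := by gcongr
      _ = _ := by ring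

end Commutator

/-! ### The main theorem -/

theorem isBoundedDomain_ball (n : ℕ) :
    IsBoundedDomain (Metric.ball (0 : EuclideanSpace ℝ (Fin n)) 1) where
  isOpen := Metric.isOpen_ball
  isConnected := ⟨⟨0, Metric.mem_ball_self one_pos⟩, (convex_ball 0 1).isPreconnected⟩
  isBounded := Metric.isBounded_ball

theorem isChengYangConstant_one_add {n : ℕ} (hn : 1 ≤ n) :
    IsChengYangConstant n (1 + 4 / (n : ℝ)) := by
  intro Ω hΩ k hk
  have hn0 : (0 : ℝ) < n := by exact_mod_cast hn
  obtain ⟨l, hl, hl0, -, hyang, -⟩ := dirichletEigenvalue_inequalities hn hΩ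
  have h := le_of_yang_inequality (s := 2 / n) (by positivity) l hl0.le (fun k => by
    have := hyang k
    have e : 2 * (2 / (n : ℝ)) = 4 / n := by ring
    rwa [e]) k hk
  have e : 2 * (2 / (n : ℝ)) = 4 / n := by ring
  rw [e] at h
  rw [hl, show dirichletEigenvalue Ω 1 = l 0 from hl 0]
  exact h

/-- One domain suffices: on the unit ball with `k = 1`, both `λ₁` and `λ₂` are positive. -/
theorem IsChengYangConstant.nonneg {n : ℕ} (hn : 1 ≤ n) {C : ℝ} (hC : IsChengYangConstant n C) :
    0 ≤ C := by
  obtain ⟨l, hl, hl0, hmono, -, -⟩ :=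
    dirichletEigenvalue_inequalities hn (isBoundedDomain_ball n)
  have h := hC _ (isBoundedDomain_ball n) 1 le_rfl
  rw [hl, show dirichletEigenvalue _ 1 = l 0 from hl 0, Nat.cast_one, Real.one_rpow,
    mul_one] at h
  exact (pos_of_mul_pos_left ((hl0.trans_le (hmono zero_le_one)).trans_le h) hl0.le).le

/-- Each pair of a domain and an index imposes a closed condition on `C`, so the infimum of the
nonempty set, bounded below by zero, is attained. -/
theorem isLeast_chengYangConstant {n : ℕ} (hn : 1 ≤ n) :
    IsLeast {C : ℝ | IsChengYangConstant n C} (chengYangConstant n) := by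
  have hne : {C : ℝ | IsChengYangConstant n C}.Nonempty := ⟨_, isChengYangConstant_one_add hn⟩
  have hbdd : BddBelow {C : ℝ | IsChengYangConstant n C} := ⟨0, fun C hC => hC.nonneg hn⟩
  have hclosed : IsClosed {C : ℝ | IsChengYangConstant n C} := by
    simp only [IsChengYangConstant, Set.ofPred_forall]
    refine isClosed_iInter fun Ω => isClosed_iInter fun _ => isClosed_iInter fun k =>
      isClosed_iInter fun _ => isClosed_le (by fun_prop) (by fun_prop)
  exact ⟨hclosed.csInf_mem hne hbdd, fun C hC => csInf_le hbdd hC⟩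

theorem mainTheorem1 (n : ℕ) (hn : 1 ≤ n) :
    IsLeast {C : ℝ | IsChengYangConstant n C} (chengYangConstant n) ∧
    chengYangConstant n ≤ 1 + 4 / (n : ℝ) ∧
    ∀ Ω : Set (EuclideanSpace ℝ (Fin n)), IsBoundedDomain Ω → ∀ k : ℕ, 1 ≤ k →
      dirichletEigenvalue Ω (k + 1) - dirichletEigenvalue Ω k ≤
        4 * dirichletEigenvalue Ω 1 * √(chengYangConstant n / n) * (k : ℝ) ^ ((1 : ℝ) / n) := by
  have hleast := isLeast_chengYangConstant hn
  refine ⟨hleast, hleast.2 (isChengYangConstant_one_add hn), fun Ω hΩ k hk => ?_⟩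
  have hn0 : (0 : ℝ) < n := by exact_mod_cast hn
  have hC := hleast.1 Ω hΩ k hk
  have hC0 : 0 ≤ chengYangConstant n := IsChengYangConstant.nonneg hn hleast.1
  obtain ⟨l, hl, hl0, -, -, hgap⟩ := dirichletEigenvalue_inequalities hn hΩ
  obtain ⟨m, rfl⟩ : ∃ m, k = m + 1 := ⟨k - 1, by omega⟩
  rw [show dirichletEigenvalue Ω 1 = l 0 from hl 0, hl] at hC ⊢
  rw [hl]
  refine (hgap m).trans ?_
  set x : ℝ := ((m + 1 : ℕ) : ℝ) with hx
  have hx0 : 0 ≤ x := Nat.cast_nonneg _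
  -- Since `k = m + 1`, the eigenvalue `λ_{k+1}` is `l (m + 1)`; the bound on it supplies a second
  -- factor `λ₁`, so the square root yields a full `λ₁` and `k^(1/n)`.
  have h1 : l 0 * l (m + 1) / n ≤
      (l 0 * x ^ ((1 : ℝ) / n)) ^ 2 * (chengYangConstant n / n) := by
    have h2 : (x ^ ((1 : ℝ) / n)) ^ 2 = x ^ ((2 : ℝ) / n) := by
      rw [← Real.rpow_two, ← Real.rpow_mul hx0]
      congr 1
      ring
    rw [mul_pow, h2, mul_div_assoc', div_le_div_iff_of_pos_right hn0]
    nlinarith [mul_le_mul_of_nonneg_left hC hl0.le]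
  refine (mul_le_mul_of_nonneg_left (Real.sqrt_le_sqrt h1) zero_le_four).trans_eq ?_
  rw [Real.sqrt_mul (by positivity), Real.sqrt_sq (by positivity)]
  ring
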